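/- All graphs are finite and simple. A realisation of a graph $G$ is a map $p\colon V(G)\to\mathbb{R}^2$; it is generic if its $2|V(G)|$ coordinates are algebraically independent over $\mathbb{Q}$. A continuous motion of $(G,p)$ is a continuous map $\phi\colon(-1,1)\times V(G)\to\mathbb{R}^2$, $\phi_t=\phi(t,\cdot)$, with $\phi_0=p$ and $\lVert\phi_t(u)-\phi_t(v)\rVert=\lVert p(u)-p(v)\rVert$ for all $t\in(-1,1)$ and all edges $uv$; it is trivial if this equality holds for all $t\in(-1,1)$ and all pairs of vertices $u,v$. The realisation $(G,p)$ is flexible if it has a nontrivial continuous motion, and rigid otherwise. A graph is rigid if all its generic realisations are rigid, and flexible otherwise. The rigid components of $G$ are its maximal rigid subgraphs. A graph is $2$-connected if it has at least three vertices, is connected, and remains connected after the deletion of any single vertex. For $E'\subseteq E(G)$, let $G[E']$ be the subgraph whose edges are those in $E'$ and whose vertices are the ends of these edges. A stable separation of $G$ is an unordered pair $\{G_1,G_2\}$ of subgraphs for which there is a partition $\{E_1,E_2\}$ of $E(G)$ with $G_1=G[E_1]$ and $G_2=G[E_2]$, such that $V(G_1)\setminus V(G_2)\neq\varnothing$, $V(G_2)\setminus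 V(G_1)\neq\varnothing$, and no two vertices of $V(G_1)\cap V(G_2)$ are adjacent in $G$. A NAC-colouring of $G$ is a surjective map $c\colon E(G)\to\{\mathrm{red},\mathrm{blue}\}$ such that every cycle of $G$ either is monochromatic or contains at least two red and at least two blue edges. Let $\nu(G)$ be the number of NAC-colourings of $G$ divided by $2$. Theorem. Let $G$ be a $2$-connected flexible graph with $\ell$ rigid components. Then $G$ has at least $\lceil\log_2\ell\rceil$ stable separations, $\nu(G)\ge\lceil\log_2\ell\rceil$, and $\nu(G)\ge 3$. -/

import Mathlib

namespace FlexGraph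

/-- The Euclidean plane. -/
abbrev Plane : Type := EuclideanSpace ℝ (Fin 2)

section Rigidity

/-- A realisation `p : V → ℝ²` is generic if the family of all its `2|V|` coordinates is
algebraically independent over `ℚ`. -/
def IsGeneric {V : Type*} (p : V → Plane) : Prop :=
  AlgebraicIndependent ℚ (fun x : V × Fin 2 => p x.1 x.2)

/-- Two realisations of `G` are equivalent if they give the same length to every edge. -/
def Equivalent {V : Type*} (G : SimpleGraph V) (p q : V → Plane) : Prop :=
  ∀ u v : V, G.Adj u v → dist (p u) (p v) = dist (q u) (q v)

/-- `φ` is a continuous motion of `(G, p)`, with time parameter in `(-1, 1)`. (The values of `φ`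
outside this interval play no role.) -/
structure IsContinuousMotion {V : Type*} (G : SimpleGraph V) (p : V → Plane)
    (φ : ℝ → V → Plane) : Prop where
  continuousOn : ContinuousOn φ (Set.Ioo (-1 : ℝ) 1)
  start : φ 0 = p
  equivalent : ∀ t ∈ Set.Ioo (-1 : ℝ) 1, Equivalent G p (φ t)

/-- A motion is trivial if `p` and `φ t` are congruent (all pairwise distances agree) for every
`t` in `(-1, 1)`. -/
def IsTrivialMotion {V : Type*} (p : V → Plane) (φ : ℝ → V → Plane) : Prop :=
  ∀ t ∈ Set.Ioo (-1 : ℝ) 1, Congruent p (φ t)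

/-- The realisation `(G, p)` is flexible if it has a nontrivial continuous motion. -/
def IsFlexibleRealisation {V : Type*} (G : SimpleGraph V) (p : V → Plane) : Prop :=
  ∃ φ : ℝ → V → Plane, IsContinuousMotion G p φ ∧ ¬ IsTrivialMotion p φ

/-- The realisation `(G, p)` is rigid if it is not flexible. -/
def IsRigidRealisation {V : Type*} (G : SimpleGraph V) (p : V → Plane) : Prop :=
  ¬ IsFlexibleRealisation G p

/-- A graph is rigid (in the plane) if its generic realisations are rigid. -/
def IsRigid {V : Type*} (G : SimpleGraph V) : Prop :=
  ∀ p : V → Plane, IsGeneric p → IsRigidRealisation G p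

/-- A graph is flexible (in the plane) if it is not rigid, that is, if it has a flexible generic
realisation. As rigidity of generic realisations depends only on the graph, it is the same to ask
that all generic realisations are flexible; what is required here is formally the least. -/
def IsFlexible {V : Type*} (G : SimpleGraph V) : Prop :=
  ¬ IsRigid G

/-- The rigid components of `G` are its maximal rigid subgraphs. -/
def IsRigidComponent {V : Type*} (G : SimpleGraph V) (R : G.Subgraph) : Prop :=
  Maximal (fun H : G.Subgraph => IsRigid H.coe) R

/-- The number of rigid components of `G`. -/
noncomputable def numRigidComponents {V : Type*} (G : SimpleGraph V) : ℕ :=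
  Set.ncard {R : G.Subgraph | IsRigidComponent G R}

end Rigidity

/-- `G` is 2-connected: it has at least three vertices, it is connected, and it stays connected
after the deletion of any one vertex. -/
structure IsTwoConnected {V : Type*} (G : SimpleGraph V) : Prop where
  three_le_card : 3 ≤ Nat.card V
  connected : G.Connected
  connected_delete : ∀ v : V, (G.induce {v}ᶜ).Connected

section Separations

/-- The edge-induced subgraph `G[E]`: its edges are the edges of `G` in `E`, and its vertices are
the ends of these edges. -/
def edgeInduced {V : Type*} (G : SimpleGraph V) (E : Set (Sym2 V)) : G.Subgraph where
  verts := {v | ∃ w, G.Adj v w ∧ s(v, w) ∈ E}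
  Adj u v := G.Adj u v ∧ s(u, v) ∈ E
  adj_sub h := h.1
  edge_vert {_ w} h := ⟨w, h⟩
  symm := ⟨fun _ _ h => ⟨h.1.symm, Sym2.eq_swap ▸ h.2⟩⟩

/-- `{G₁, G₂}` is a separation of `G`. The two classes of the partition `{E₁, E₂}` of `E(G)` are
nonempty because each of `G₁`, `G₂` is required to have a vertex that is not in the other. -/
def IsSeparation {V : Type*} (G : SimpleGraph V) (G₁ G₂ : G.Subgraph) : Prop :=
  (∃ E₁ E₂ : Set (Sym2 V), E₁ ∪ E₂ = G.edgeSet ∧ Disjoint E₁ E₂ ∧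
    G₁ = edgeInduced G E₁ ∧ G₂ = edgeInduced G E₂) ∧
  (G₁.verts \ G₂.verts).Nonempty ∧ (G₂.verts \ G₁.verts).Nonempty

/-- The separation `{G₁, G₂}` is stable if `V(G₁ ∩ G₂)` is a stable set of `G`. -/
def IsStableSeparation {V : Type*} (G : SimpleGraph V) (G₁ G₂ : G.Subgraph) : Prop :=
  IsSeparation G G₁ G₂ ∧ G.IsIndepSet (G₁ ⊓ G₂).verts

/-- The number of stable separations of `G`, counted as unordered pairs `{G₁, G₂}`. -/
noncomputable def numStableSeparations {V : Type*} (G : SimpleGraph V) : ℕ :=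
  Set.ncard {P : Sym2 G.Subgraph | ∃ G₁ G₂ : G.Subgraph, P = s(G₁, G₂) ∧
    IsStableSeparation G G₁ G₂}

end Separations

section NAC

/-- The two colours. -/
inductive Colour where
  | red
  | blue

/-- The set of edges of colour `a` on the closed walk `w`. -/
def colouredEdges {V : Type*} {G : SimpleGraph V} (c : G.edgeSet → Colour) {v : V}
    (w : G.Walk v v) (a : Colour) : Set G.edgeSet :=
  {e | (e : Sym2 V) ∈ w.edges ∧ c e = a}

/-- A NAC-colouring is a surjective edge colouring with colours red and blue such that every
cycle is monochromatic or has at least two red and at least two blue edges. -/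
def IsNACColouring {V : Type*} (G : SimpleGraph V) (c : G.edgeSet → Colour) : Prop :=
  Function.Surjective c ∧
  ∀ (v : V) (w : G.Walk v v), w.IsCycle →
    (∃ a : Colour, ∀ e : G.edgeSet, (e : Sym2 V) ∈ w.edges → c e = a) ∨
    (2 ≤ (colouredEdges c w Colour.red).ncard ∧ 2 ≤ (colouredEdges c w Colour.blue).ncard)

/-- `ν(G)`: the number of NAC-colourings of `G`, divided by two. -/
noncomputable def nu {V : Type*} (G : SimpleGraph V) : ℚ :=
  (Set.ncard {c : G.edgeSet → Colour | IsNACColouring G c} : ℚ) / 2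

end NAC

end FlexGraph

/-!
Take a maximal Laman-sparse set `E` of edges and call the maximal vertex sets spanning `2k - 3`
edges of `E` bodies. The vertex set of every rigid component contains a body: a body is rigid by
Laman's theorem, here proved by Henneberg reductions, and two rigid subgraphs with two common
vertices have a rigid union. Hence there are at least `ℓ` bodies.

The bodies again form a sparse system, and a maximality argument turns this into the following:
given a vertex `u` and a body `D` with `u ∉ D`, either some tight set of bodies contains both, or
contracting the bodies at `u` one by one separates `u` from `D` by a stable set. As no body contains
another, the stable separations distinguish the bodies, so there are at most `2 ^ s` bodies, where
`s` is the number of stable separations, and `ℓ ≤ 2 ^ s`.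

A stable separation yields two NAC-colourings, so `s ≤ ν`. Finally a `2`-connected flexible graph
has at least four bodies. If there are five, then `2 ^ s ≥ 5` forces `s ≥ 3`. If there are exactly
four, every splitting of them into two pairs is a NAC-colouring, and there are six such splittings.
-/

namespace FlexGraph

section SparseSystems

open Finset

variable {V : Type*} [DecidableEq V] {𝓒 𝓓 : Finset (Finset V)} {C D F X Y : Finset V}

/-- The count of a system of bodies on a vertex set `X`: a body meeting `X` in `k ≥ 2` vertices
contributes `2 * k - 3`, the rank of a rigid graph on `k` vertices, and the truncated subtraction
discards the other bodies. -/
def spread (𝓒 : Finset (Finset V)) (X : Finset V) : ℕ := ∑ C ∈ 𝓒, (2 * #(C ∩ X) - 3)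

/-- Laman's sparsity condition for a system of bodies; for a system of pairs it is the usual
condition on the edge set of a graph. -/
def IsSparse (𝓒 : Finset (Finset V)) : Prop :=
  ∀ X : Finset V, 2 ≤ #X → spread 𝓒 X + 3 ≤ 2 * #X

/-- A vertex set at which the sparsity condition holds with equality. -/
def IsTight (𝓒 : Finset (Finset V)) (X : Finset V) : Prop :=
  2 ≤ #X ∧ spread 𝓒 X + 3 = 2 * #X

/-- A sparse system of nontrivial bodies in which every tight set lies in a body. -/
structure IsSaturated (𝓒 : Finset (Finset V)) : Prop where
  sparse : IsSparse 𝓒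
  two_le_card : ∀ C ∈ 𝓒, 2 ≤ #C
  exists_superset : ∀ X, IsTight 𝓒 X → ∃ C ∈ 𝓒, X ⊆ C

lemma spread_mono_left (h : 𝓒 ⊆ 𝓓) (X : Finset V) : spread 𝓒 X ≤ spread 𝓓 X :=
  sum_le_sum_of_subset h

lemma spread_mono_right (𝓒 : Finset (Finset V)) (h : X ⊆ Y) : spread 𝓒 X ≤ spread 𝓒 Y := by
  unfold spread
  gcongr

lemma le_spread_of_mem (hC : C ∈ 𝓒) (X : Finset V) : 2 * #(C ∩ X) - 3 ≤ spread 𝓒 X :=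
  single_le_sum (f := fun C => 2 * #(C ∩ X) - 3) (fun _ _ => Nat.zero_le _) hC

lemma spread_eq_zero_of_card_le_one (𝓒 : Finset (Finset V)) (h : #X ≤ 1) : spread 𝓒 X = 0 :=
  sum_eq_zero fun C _ => by
    have := card_le_card (inter_subset_right (s₁ := C) (s₂ := X))
    omega

lemma spread_inter_biUnion (𝓒 : Finset (Finset V)) (X : Finset V) :
    spread 𝓒 (X ∩ 𝓒.biUnion id) = spread 𝓒 X :=
  sum_congr rfl fun C hC => by
    have hsub : C ⊆ 𝓒.biUnion id := subset_biUnion_of_mem id hC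
    rw [inter_comm X, ← inter_assoc, inter_eq_left.2 hsub]

lemma card_inter_union_add_card_inter_inter (C X Y : Finset V) :
    #(C ∩ (X ∪ Y)) + #(C ∩ (X ∩ Y)) = #(C ∩ X) + #(C ∩ Y) := by
  rw [inter_union_distrib_left, inter_inter_distrib_left, card_union_add_card_inter]

lemma spread_add_spread_le (𝓒 : Finset (Finset V)) (X Y : Finset V) :
    spread 𝓒 X + spread 𝓒 Y ≤ spread 𝓒 (X ∪ Y) + spread 𝓒 (X ∩ Y) := by
  unfold spread
  rw [← sum_add_distrib, ← sum_add_distrib]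
  refine sum_le_sum fun C _ => ?_
  have hsum := card_inter_union_add_card_inter_inter C X Y
  have hX : #(C ∩ (X ∩ Y)) ≤ #(C ∩ X) := by gcongr; exact inter_subset_left
  have hY : #(C ∩ (X ∩ Y)) ≤ #(C ∩ Y) := by gcongr; exact inter_subset_right
  omega

lemma spread_add_spread_lt (hC : C ∈ 𝓒) (hX : #(C ∩ X) = 2) (hY : #(C ∩ Y) = 2)
    (hXY : #(C ∩ (X ∩ Y)) ≤ 1) :
    spread 𝓒 X + spread 𝓒 Y < spread 𝓒 (X ∪ Y) + spread 𝓒 (X ∩ Y) := by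
  have hrest := spread_add_spread_le (𝓒.erase C) X Y
  have hsum := card_inter_union_add_card_inter_inter C X Y
  unfold spread at *
  rw [← add_sum_erase 𝓒 _ hC, ← add_sum_erase 𝓒 _ hC, ← add_sum_erase 𝓒 _ hC,
    ← add_sum_erase 𝓒 _ hC]
  omega

lemma IsSparse.mono (h : 𝓒 ⊆ 𝓓) (hs : IsSparse 𝓓) : IsSparse 𝓒 :=
  fun X hX => (Nat.add_le_add_right (spread_mono_left h X) 3).trans (hs X hX)

lemma IsSparse.isTight_of_le (hs : IsSparse 𝓒) (hX : 2 ≤ #X) (h : 2 * #X ≤ spread 𝓒 X + 3) :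
    IsTight 𝓒 X :=
  ⟨hX, le_antisymm (hs X hX) h⟩

lemma IsSparse.isTight_of_subset_mem (hs : IsSparse 𝓒) (hC : C ∈ 𝓒) (hX : 2 ≤ #X) (h : X ⊆ C) :
    IsTight 𝓒 X := by
  have hspread := le_spread_of_mem hC X
  rw [inter_eq_right.2 h] at hspread
  exact hs.isTight_of_le hX (by omega)

lemma IsTight.union (hs : IsSparse 𝓒) (hX : IsTight 𝓒 X) (hY : IsTight 𝓒 Y)
    (h : 2 ≤ #(X ∩ Y)) : IsTight 𝓒 (X ∪ Y) := by
  obtain ⟨hX2, hX⟩ := hX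
  obtain ⟨-, hY⟩ := hY
  have hinter := hs _ h
  have hsuper := spread_add_spread_le 𝓒 X Y
  have hcard := card_union_add_card_inter X Y
  have hle : #X ≤ #(X ∪ Y) := card_le_card subset_union_left
  exact hs.isTight_of_le (by omega) (by omega)

lemma IsTight.subset_biUnion (hs : IsSparse 𝓒) (hX : IsTight 𝓒 X) : X ⊆ 𝓒.biUnion id := by
  have htight := hX.2
  have hspread := spread_inter_biUnion 𝓒 X
  refine inter_eq_left.1 (eq_of_subset_of_card_le inter_subset_left ?_)
  by_cases h : 2 ≤ #(X ∩ 𝓒.biUnion id)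
  · have := hs _ h
    omega
  · have := spread_eq_zero_of_card_le_one 𝓒 (X := X ∩ 𝓒.biUnion id) (by omega)
    omega

lemma IsSaturated.card_inter_le_one (h : IsSaturated 𝓒) (hC : C ∈ 𝓒) (hD : D ∈ 𝓒)
    (hCD : C ≠ D) : #(C ∩ D) ≤ 1 := by
  by_contra! hlt
  have hsparse := h.sparse _ hlt
  have hpair : spread {C, D} (C ∩ D) ≤ spread 𝓒 (C ∩ D) :=
    spread_mono_left (by simp [insert_subset_iff, hC, hD]) _
  rw [spread, sum_pair hCD, inter_eq_right.2 inter_subset_left,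
    inter_eq_right.2 inter_subset_right] at hpair
  omega

lemma IsSaturated.eq_of_mem (h : IsSaturated 𝓒) (hC : C ∈ 𝓒) (hD : D ∈ 𝓒) {x y : V}
    (hxy : x ≠ y) (hxC : x ∈ C) (hyC : y ∈ C) (hxD : x ∈ D) (hyD : y ∈ D) : C = D := by
  by_contra hCD
  exact hxy (card_le_one.1 (h.card_inter_le_one hC hD hCD) x (by simp [*]) y (by simp [*]))

/-- If the three bodies of a triangle were distinct, their union would be tight. -/
lemma IsSaturated.eq_of_triangle (h : IsSaturated 𝓒) (hC : C ∈ 𝓒) (hD : D ∈ 𝓒) (hF : F ∈ 𝓒)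
    {x y z : V} (hxy : x ≠ y) (hyz : y ≠ z) (hxC : x ∈ C) (hxD : x ∈ D) (hyC : y ∈ C)
    (hyF : y ∈ F) (hzD : z ∈ D) (hzF : z ∈ F) (hCD : C ≠ D) : C = F := by
  by_contra hCF
  have hDF : D ≠ F := by
    rintro rfl
    exact hCD (h.eq_of_mem hC hD hxy hxC hyC hxD hyF)
  have hspread : spread {C, D, F} (C ∪ D ∪ F) ≤ spread 𝓒 (C ∪ D ∪ F) :=
    spread_mono_left (by simp [insert_subset_iff, hC, hD, hF]) _
  rw [spread, sum_insert (by simp [hCD, hCF]), sum_pair hDF,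
    inter_eq_left.2 (subset_union_left.trans subset_union_left),
    inter_eq_left.2 (subset_union_right.trans subset_union_left),
    inter_eq_left.2 subset_union_right] at hspread
  have htight : IsTight 𝓒 (C ∪ D ∪ F) := by
    have hcard₁ := card_union_add_card_inter C D
    have hcard₂ := card_union_add_card_inter (C ∪ D) F
    have hCD_pos : 0 < #(C ∩ D) := card_pos.2 ⟨x, by simp [*]⟩
    have hF_two : 2 ≤ #((C ∪ D) ∩ F) := by
      rw [← card_pair hyz]
      exact card_le_card (by simp [insert_subset_iff, *])
    have hC2 := h.two_le_card C hC
    have hD2 := h.two_le_card D hD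
    have hF2 := h.two_le_card F hF
    have hle : #F ≤ #(C ∪ D ∪ F) := card_le_card subset_union_right
    exact h.sparse.isTight_of_le (by omega) (by omega)
  obtain ⟨R, hR, hsub⟩ := h.exists_superset _ htight
  have hCR : C = R := h.eq_of_mem hC hR hxy hxC hyC (hsub (by simp [*])) (hsub (by simp [*]))
  have hFR : F = R := h.eq_of_mem hF hR hyz hyF hzF (hsub (by simp [*])) (hsub (by simp [*]))
  exact hCF (hCR.trans hFR.symm)

lemma card_union_biUnion_add_sum_le (Y : Finset V) (𝓡 : Finset (Finset V)) :
    #(Y ∪ 𝓡.biUnion id) + ∑ R ∈ 𝓡, #(R ∩ Y) ≤ #Y + ∑ R ∈ 𝓡, #R := by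
  have hunion : Y ∪ 𝓡.biUnion id = Y ∪ 𝓡.biUnion (· \ Y) := by
    ext x
    simp only [mem_union, mem_biUnion, id, mem_sdiff]
    tauto
  have hsum : ∑ R ∈ 𝓡, #(R \ Y) + ∑ R ∈ 𝓡, #(R ∩ Y) = ∑ R ∈ 𝓡, #R := by
    rw [← sum_add_distrib]
    exact sum_congr rfl fun R _ => card_sdiff_add_card_inter R Y
  have hle₁ := card_union_le Y (𝓡.biUnion (· \ Y))
  have hle₂ : #(𝓡.biUnion (· \ Y)) ≤ ∑ R ∈ 𝓡, #(R \ Y) := card_biUnion_le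
  rw [hunion]
  omega

section Components

variable [Finite V] {R T : Finset V}

/-- The maximal tight sets of a system, the rigid bodies that it generates. -/
noncomputable def components (𝓒 : Finset (Finset V)) : Finset (Finset V) :=
  (Set.toFinite {X | Maximal (IsTight 𝓒) X}).toFinset

lemma mem_components : X ∈ components 𝓒 ↔ Maximal (IsTight 𝓒) X := by
  simp [components]

lemma IsTight.exists_mem_components (hX : IsTight 𝓒 X) : ∃ R ∈ components 𝓒, X ⊆ R := by
  obtain ⟨R, hXR, hR⟩ := (Set.toFinite {Y | IsTight 𝓒 Y}).exists_le_maximal hX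
  exact ⟨R, mem_components.2 hR, hXR⟩

lemma IsSparse.card_inter_le_one (hs : IsSparse 𝓒) (hR : R ∈ components 𝓒)
    (hT : T ∈ components 𝓒) (h : R ≠ T) : #(R ∩ T) ≤ 1 := by
  rw [mem_components] at hR hT
  by_contra! hlt
  have hunion := hR.1.union hs hT.1 hlt
  exact h ((hR.eq_of_le hunion subset_union_left).trans
    (hT.eq_of_le hunion subset_union_right).symm)

lemma IsSparse.exists_card_inter_le_one (hs : IsSparse 𝓒) (hC : C ∈ 𝓒) (hC2 : 2 ≤ #C) :
    ∃ R₀ ∈ components 𝓒, ∀ R ∈ components 𝓒, R ≠ R₀ → #(C ∩ R) ≤ 1 := by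
  obtain ⟨R₀, hR₀, hCR₀⟩ :=
    (hs.isTight_of_subset_mem hC hC2 subset_rfl).exists_mem_components
  exact ⟨R₀, hR₀, fun R hR hne => (card_le_card (inter_subset_inter_right hCR₀)).trans
    (hs.card_inter_le_one hR₀ hR hne.symm)⟩

lemma IsSparse.sum_spread_le (hs : IsSparse 𝓒) {𝓡 : Finset (Finset V)} (h𝓡 : 𝓡 ⊆ components 𝓒)
    (hX : ∀ R ∈ 𝓡, R ⊆ X) : ∑ R ∈ 𝓡, spread 𝓒 R ≤ spread 𝓒 X := by
  unfold spread
  rw [sum_comm]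
  refine sum_le_sum fun C hC => ?_
  by_cases hC2 : 2 ≤ #C
  · obtain ⟨R₀, -, hR₀⟩ := hs.exists_card_inter_le_one hC hC2
    calc ∑ R ∈ 𝓡, (2 * #(C ∩ R) - 3)
        ≤ ∑ R ∈ 𝓡, if R = R₀ then 2 * #(C ∩ X) - 3 else 0 := sum_le_sum fun R hR => by
          split_ifs with hRR₀
          · have : #(C ∩ R) ≤ #(C ∩ X) := card_le_card (inter_subset_inter_left (hX R hR))
            omega
          · have := hR₀ R (h𝓡 hR) hRR₀
            omega
      _ ≤ 2 * #(C ∩ X) - 3 := by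
          rw [sum_ite_eq']
          split_ifs <;> omega
  · refine (sum_eq_zero fun R _ => ?_).trans_le (Nat.zero_le _)
    have : #(C ∩ R) ≤ #C := card_le_card inter_subset_left
    omega

/-- The witness is the union of `Y` with all components meeting it in at least two vertices. -/
lemma IsSparse.exists_spread_components_le (hs : IsSparse 𝓒) (Y : Finset V) :
    ∃ Z, Y ⊆ Z ∧ spread (components 𝓒) Y + 2 * #Z ≤ 2 * #Y + spread 𝓒 Z := by
  set 𝓡 := (components 𝓒).filter (fun R => 2 ≤ #(R ∩ Y))
  refine ⟨Y ∪ 𝓡.biUnion id, subset_union_left, ?_⟩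
  have hcard := card_union_biUnion_add_sum_le Y 𝓡
  have hspread : ∑ R ∈ 𝓡, spread 𝓒 R ≤ spread 𝓒 (Y ∪ 𝓡.biUnion id) :=
    hs.sum_spread_le (filter_subset _ _) fun R hR =>
      (subset_biUnion_of_mem id hR).trans subset_union_right
  have hcomponents : spread (components 𝓒) Y + ∑ R ∈ 𝓡, 3 = ∑ R ∈ 𝓡, 2 * #(R ∩ Y) := by
    have hrestrict : spread (components 𝓒) Y = ∑ R ∈ 𝓡, (2 * #(R ∩ Y) - 3) :=
      (sum_filter_of_ne fun R _ hne => by omega).symm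
    rw [hrestrict, ← sum_add_distrib]
    refine sum_congr rfl fun R hR => ?_
    have := (mem_filter.1 hR).2
    omega
  have htight : ∑ R ∈ 𝓡, spread 𝓒 R + ∑ R ∈ 𝓡, 3 = ∑ R ∈ 𝓡, 2 * #R := by
    rw [← sum_add_distrib]
    exact sum_congr rfl fun R hR => (mem_components.1 (mem_filter.1 hR).1).1.2
  rw [← mul_sum] at hcomponents htight
  omega

lemma IsSparse.isSaturated_components (hs : IsSparse 𝓒) : IsSaturated (components 𝓒) where
  sparse Y hY := by
    obtain ⟨Z, hYZ, hle⟩ := hs.exists_spread_components_le Y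
    have := hs Z (hY.trans (card_le_card hYZ))
    omega
  two_le_card C hC := (mem_components.1 hC).1.1
  exists_superset Y hY := by
    obtain ⟨hY2, hY⟩ := hY
    obtain ⟨Z, hYZ, hle⟩ := hs.exists_spread_components_le Y
    obtain ⟨R, hR, hZR⟩ :=
      (hs.isTight_of_le (hY2.trans (card_le_card hYZ)) (by omega)).exists_mem_components
    exact ⟨R, hR, hYZ.trans hZR⟩

end Components

end SparseSystems

section Contraction

open Finset

variable {V : Type*} [DecidableEq V] {𝓒 : Finset (Finset V)} {A C D Q S T X : Finset V} {u q : V}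

/-- The image of a body when the vertex `q` is merged into `u`. -/
def merge (u q : V) (C : Finset V) : Finset V :=
  if q ∈ C then insert u (C.erase q) else C

/-- The system of bodies obtained by merging the vertex `q` into `u`. -/
def contract (u q : V) (𝓒 : Finset (Finset V)) : Finset (Finset V) :=
  𝓒.image (merge u q)

lemma merge_mem_contract (u q : V) (hC : C ∈ 𝓒) : merge u q C ∈ contract u q 𝓒 :=
  mem_image_of_mem _ hC

lemma mem_merge_of_mem (u : V) (hq : q ∈ C) : u ∈ merge u q C := by
  rw [merge, if_pos hq]
  exact mem_insert_self _ _

lemma erase_subset_merge (u q : V) (C : Finset V) : C.erase q ⊆ merge u q C := by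
  unfold merge
  split_ifs
  exacts [subset_insert _ _, erase_subset _ _]

lemma merge_subset_insert (u q : V) (C : Finset V) : merge u q C ⊆ insert u C := by
  unfold merge
  split_ifs
  exacts [insert_subset_insert _ (erase_subset _ _), subset_insert _ _]

lemma notMem_merge (huq : u ≠ q) (C : Finset V) : q ∉ merge u q C := by
  unfold merge
  split_ifs with hq
  · simp [huq.symm]
  · exact hq

lemma notMem_biUnion_contract (huq : u ≠ q) (𝓒 : Finset (Finset V)) :
    q ∉ (contract u q 𝓒).biUnion id := by
  simp only [contract, mem_biUnion, mem_image, id, exists_exists_and_eq_and, not_exists, not_and]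
  exact fun C _ => notMem_merge huq C

lemma card_merge_inter (huX : u ∈ X) (hqX : q ∉ X) (hC : ¬ (u ∈ C ∧ q ∈ C)) :
    #(merge u q C ∩ X) = #(C ∩ insert q X) := by
  unfold merge
  split_ifs with hq
  · have hu : u ∉ C := fun hu => hC ⟨hu, hq⟩
    rw [insert_inter_of_mem huX, inter_insert_of_mem hq,
      card_insert_of_notMem (by simp [hu]), card_insert_of_notMem (by simp [hqX]),
      erase_inter, erase_eq_of_notMem (by simp [hqX])]
  · rw [inter_insert_of_notMem hq]

lemma merge_inter_of_mem (huq : u ≠ q) (hqX : q ∉ X) (hu : u ∈ C) (hq : q ∈ C) :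
    merge u q C ∩ X = C ∩ X := by
  rw [merge, if_pos hq, insert_eq_of_mem (by simp [hu, huq]), erase_inter,
    erase_eq_of_notMem (by simp [hqX])]

lemma spread_contract_le_sum (u q : V) (𝓒 : Finset (Finset V)) (X : Finset V) :
    spread (contract u q 𝓒) X ≤ ∑ C ∈ 𝓒, (2 * #(merge u q C ∩ X) - 3) :=
  sum_image_le_of_nonneg (f := fun C => 2 * #(C ∩ X) - 3) fun _ _ => Nat.zero_le _

lemma spread_contract_le (hu : u ∉ X) : spread (contract u q 𝓒) X ≤ spread 𝓒 X := by
  refine (spread_contract_le_sum u q 𝓒 X).trans (sum_le_sum fun C _ => ?_)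
  have hsub : merge u q C ∩ X ⊆ C ∩ X :=
    (inter_subset_inter_right (merge_subset_insert u q C)).trans_eq (insert_inter_of_notMem hu)
  have := card_le_card hsub
  omega

lemma IsSaturated.spread_contract_add_le (h : IsSaturated 𝓒) (hQ : Q ∈ 𝓒) (hu : u ∈ Q)
    (hq : q ∈ Q) (huq : u ≠ q) (huX : u ∈ X) (hqX : q ∉ X) :
    spread (contract u q 𝓒) X + (2 * #(Q ∩ insert q X) - 3) ≤
      spread 𝓒 (insert q X) + (2 * #(Q ∩ X) - 3) := by
  have hothers : ∑ C ∈ 𝓒.erase Q, (2 * #(merge u q C ∩ X) - 3) =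
      ∑ C ∈ 𝓒.erase Q, (2 * #(C ∩ insert q X) - 3) := by
    refine sum_congr rfl fun C hC => ?_
    obtain ⟨hCQ, hC⟩ := mem_erase.1 hC
    rw [card_merge_inter huX hqX]
    exact fun ⟨huC, hqC⟩ => hCQ (h.eq_of_mem hC hQ huq huC hqC hu hq)
  have hle := spread_contract_le_sum u q 𝓒 X
  rw [← add_sum_erase 𝓒 _ hQ, merge_inter_of_mem huq hqX hu hq, hothers] at hle
  rw [spread.eq_1 𝓒, ← add_sum_erase 𝓒 _ hQ]
  omega

lemma card_inter_insert_of_mem (hq : q ∈ Q) (hqX : q ∉ X) : #(Q ∩ insert q X) = #(Q ∩ X) + 1 := by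
  rw [inter_insert_of_mem hq, card_insert_of_notMem (by simp [hqX])]

lemma IsSaturated.spread_contract_add_three_le (h : IsSaturated 𝓒) (hQ : Q ∈ 𝓒) (hu : u ∈ Q)
    (hq : q ∈ Q) (huq : u ≠ q) (hqX : q ∉ X) (hX : 2 ≤ #X) :
    spread (contract u q 𝓒) X + 3 ≤ 2 * #X := by
  by_cases huX : u ∈ X
  · have hle := h.spread_contract_add_le hQ hu hq huq huX hqX
    have hinsert : #(insert q X) = #X + 1 := card_insert_of_notMem hqX
    have hQX := card_inter_insert_of_mem hq hqX
    have hpos : 0 < #(Q ∩ X) := card_pos.2 ⟨u, by simp [hu, huX]⟩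
    have hle_insert := h.sparse (insert q X) (by omega)
    by_cases htight : IsTight 𝓒 (insert q X)
    · obtain ⟨R, hR, hsub⟩ := h.exists_superset _ htight
      obtain rfl : R = Q := h.eq_of_mem hR hQ huq (hsub (by simp [huX])) (hsub (by simp)) hu hq
      rw [inter_eq_right.2 hsub] at hQX hle
      omega
    · have hne : spread 𝓒 (insert q X) + 3 ≠ 2 * #(insert q X) :=
        fun heq => htight ⟨by omega, heq⟩
      omega
  · exact (Nat.add_le_add_right (spread_contract_le huX) 3).trans (h.sparse X hX)

lemma spread_contract_erase (huq : u ≠ q) (𝓒 : Finset (Finset V)) (X : Finset V) :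
    spread (contract u q 𝓒) (X.erase q) = spread (contract u q 𝓒) X := by
  rw [← spread_inter_biUnion _ X, ← spread_inter_biUnion _ (X.erase q), erase_inter,
    erase_eq_of_notMem fun hmem => notMem_biUnion_contract huq 𝓒 (mem_of_mem_inter_right hmem)]

lemma IsSaturated.isSparse_contract (h : IsSaturated 𝓒) (hQ : Q ∈ 𝓒) (hu : u ∈ Q) (hq : q ∈ Q)
    (huq : u ≠ q) : IsSparse (contract u q 𝓒) := by
  intro X hX
  have hle : #(X.erase q) ≤ #X := card_erase_le
  rw [← spread_contract_erase huq]
  by_cases h2 : 2 ≤ #(X.erase q)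
  · have := h.spread_contract_add_three_le hQ hu hq huq (notMem_erase _ _) h2
    omega
  · rw [spread_eq_zero_of_card_le_one _ (by omega)]
    omega

/-- Some tight set contains the vertex `u` and the set `D`, so that no stable set can separate `u`
from `D`. -/
def IsJoined (𝓒 : Finset (Finset V)) (u : V) (D : Finset V) : Prop :=
  ∃ T, IsTight 𝓒 T ∧ u ∈ T ∧ D ⊆ T

lemma IsSaturated.exists_of_isJoined_contract (h : IsSaturated 𝓒) (hQ : Q ∈ 𝓒) (hu : u ∈ Q)
    (hq : q ∈ Q) (huq : u ≠ q) (hD : ¬ IsJoined 𝓒 u D) (hj : IsJoined (contract u q 𝓒) u D) :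
    ∃ Y, D ⊆ Y ∧ Q ∩ Y = {u, q} ∧ 2 * #Y ≤ spread 𝓒 Y + 4 := by
  obtain ⟨T, hT, huT, hDT⟩ := hj
  have hqT : q ∉ T := fun hqT => notMem_biUnion_contract huq 𝓒
    (hT.subset_biUnion (h.isSparse_contract hQ hu hq huq) hqT)
  obtain ⟨hT2, hT⟩ := hT
  have hle := h.spread_contract_add_le hQ hu hq huq huT hqT
  have hinsert : #(insert q T) = #T + 1 := card_insert_of_notMem hqT
  have hQT := card_inter_insert_of_mem hq hqT
  have hpos : 0 < #(Q ∩ T) := card_pos.2 ⟨u, by simp [hu, huT]⟩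
  have hone : #(Q ∩ T) ≤ 1 := by
    by_contra! htwo
    exact hD ⟨insert q T, h.sparse.isTight_of_le (by omega) (by omega), by simp [huT],
      hDT.trans (subset_insert _ _)⟩
  refine ⟨insert q T, hDT.trans (subset_insert _ _), (eq_of_subset_of_card_le ?_ ?_).symm,
    by omega⟩
  · simp [insert_subset_iff, hu, hq, huT]
  · rw [card_pair huq]
    omega

/-- The strict supermodular inequality at `Q` makes the union or the intersection tight. -/
lemma IsSparse.isJoined_of_inter_eq_pair (hs : IsSparse 𝓒) (hQ : Q ∈ 𝓒) {q₁ q₂ : V}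
    (hu₁ : u ≠ q₁) (hu₂ : u ≠ q₂) (hne : q₁ ≠ q₂) (hD : 2 ≤ #D) {Y₁ Y₂ : Finset V}
    (hD₁ : D ⊆ Y₁) (hQ₁ : Q ∩ Y₁ = {u, q₁}) (hY₁ : 2 * #Y₁ ≤ spread 𝓒 Y₁ + 4)
    (hD₂ : D ⊆ Y₂) (hQ₂ : Q ∩ Y₂ = {u, q₂}) (hY₂ : 2 * #Y₂ ≤ spread 𝓒 Y₂ + 4) :
    IsJoined 𝓒 u D := by
  have hQ_inter : Q ∩ (Y₁ ∩ Y₂) = {u} := by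
    rw [inter_inter_distrib_left, hQ₁, hQ₂]
    ext x
    simp only [mem_inter, mem_insert, mem_singleton]
    grind
  have hlt := spread_add_spread_lt hQ (by rw [hQ₁, card_pair hu₁]) (by rw [hQ₂, card_pair hu₂])
    (by rw [hQ_inter, card_singleton])
  have hu_inter : u ∈ Y₁ ∩ Y₂ := mem_of_mem_inter_right (hQ_inter ▸ mem_singleton_self u)
  have hD_inter : D ⊆ Y₁ ∩ Y₂ := subset_inter hD₁ hD₂
  have hsub : Y₁ ∩ Y₂ ⊆ Y₁ ∪ Y₂ := inter_subset_left.trans subset_union_left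
  have hinter : 2 ≤ #(Y₁ ∩ Y₂) := hD.trans (card_le_card hD_inter)
  have hunion : 2 ≤ #(Y₁ ∪ Y₂) := hinter.trans (card_le_card hsub)
  have hcard := card_union_add_card_inter Y₁ Y₂
  by_cases htight : 2 * #(Y₁ ∪ Y₂) ≤ spread 𝓒 (Y₁ ∪ Y₂) + 3
  · exact ⟨_, hs.isTight_of_le hunion htight, hsub hu_inter, hD_inter.trans hsub⟩
  · exact ⟨_, hs.isTight_of_le hinter (by omega), hu_inter, hD_inter⟩

lemma IsSaturated.card_inter_le_one_of_not_isJoined (h : IsSaturated 𝓒) (hQ : Q ∈ 𝓒) (hu : u ∈ Q)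
    (hDt : IsTight 𝓒 D) (hD : ¬ IsJoined 𝓒 u D) : #(Q ∩ D) ≤ 1 := by
  obtain ⟨R, hR, hDR⟩ := h.exists_superset D hDt
  have hRQ : Q ≠ R := by
    rintro rfl
    exact hD ⟨Q, h.sparse.isTight_of_subset_mem hQ (h.two_le_card Q hQ) subset_rfl, hu, hDR⟩
  exact (card_le_card (inter_subset_inter_left hDR)).trans (h.card_inter_le_one hQ hR hRQ)

lemma IsSaturated.exists_not_isJoined_contract (h : IsSaturated 𝓒) (hQ : Q ∈ 𝓒) (hu : u ∈ Q)
    (hQ3 : 3 ≤ #Q) (hDt : IsTight 𝓒 D) (hD : ¬ IsJoined 𝓒 u D) :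
    ∃ q ∈ Q, u ≠ q ∧ q ∉ D ∧ ¬ IsJoined (contract u q 𝓒) u D := by
  by_contra! hcon
  have hnear : ∀ q ∈ Q, u ≠ q → q ∉ D →
      ∃ Y, D ⊆ Y ∧ Q ∩ Y = {u, q} ∧ 2 * #Y ≤ spread 𝓒 Y + 4 := fun q hq huq hqD =>
    h.exists_of_isJoined_contract hQ hu hq huq hD (hcon q hq huq hqD)
  have hnotMem : ∀ a ∈ Q, ∀ b ∈ Q, u ≠ a → u ≠ b → a ≠ b → a ∉ D := by
    intro a ha b hb hua hub hab haD
    have hbD : b ∉ D := fun hbD => hab <| card_le_one.1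
      (h.card_inter_le_one_of_not_isJoined hQ hu hDt hD) a (by simp [*]) b (by simp [*])
    obtain ⟨Y, hDY, hQY, -⟩ := hnear b hb hub hbD
    have hmem : a ∈ ({u, b} : Finset V) := hQY ▸ mem_inter.2 ⟨ha, hDY haD⟩
    simp [hua.symm, hab] at hmem
  obtain ⟨q₁, q₂, hq₁, hq₂, hne⟩ : ∃ q₁ q₂, q₁ ∈ Q.erase u ∧ q₂ ∈ Q.erase u ∧ q₁ ≠ q₂ :=
    one_lt_card_iff.1 (by rw [card_erase_of_mem hu]; omega)
  obtain ⟨hu₁, hq₁⟩ := mem_erase.1 hq₁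
  obtain ⟨hu₂, hq₂⟩ := mem_erase.1 hq₂
  obtain ⟨Y₁, hD₁, hQ₁, hY₁⟩ :=
    hnear q₁ hq₁ hu₁.symm (hnotMem q₁ hq₁ q₂ hq₂ hu₁.symm hu₂.symm hne)
  obtain ⟨Y₂, hD₂, hQ₂, hY₂⟩ :=
    hnear q₂ hq₂ hu₂.symm (hnotMem q₂ hq₂ q₁ hq₁ hu₂.symm hu₁.symm hne.symm)
  exact hD (h.sparse.isJoined_of_inter_eq_pair hQ hu₁.symm hu₂.symm hne hDt.1
    hD₁ hQ₁ hY₁ hD₂ hQ₂ hY₂)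

/-- A set of vertices `A` with a stable boundary contained in `S`: every body meets `S` in at most
one vertex, and a body that meets `A` stays in `A ∪ S`. -/
structure IsStableSide (𝓒 : Finset (Finset V)) (A S : Finset V) : Prop where
  disjoint : Disjoint A S
  card_inter_le_one : ∀ C ∈ 𝓒, #(C ∩ S) ≤ 1
  subset_union : ∀ C ∈ 𝓒, ∀ x ∈ C, x ∈ A → C ⊆ A ∪ S

lemma IsSaturated.isStableSide_singleton (h : IsSaturated 𝓒) (hu : ∀ C ∈ 𝓒, u ∈ C → #C < 3) :
    IsStableSide 𝓒 {u} (((𝓒.filter (u ∈ ·)).biUnion id).erase u) where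
  disjoint := by simp
  card_inter_le_one C hC := by
    have hthree : ∀ B ∈ 𝓒, u ∈ B → ∀ b ∈ B, ∀ c ∈ B, u ≠ b → u ≠ c → b = c := by
      intro B hB huB b hbB c hcB hub huc
      by_contra hbc
      exact (hu B hB huB).not_ge (two_lt_card.2 ⟨u, huB, b, hbB, c, hcB, hub, huc, hbc⟩)
    rw [card_le_one]
    intro b hb c hc
    simp only [mem_inter, mem_erase, mem_biUnion, mem_filter, id] at hb hc
    obtain ⟨hbC, hbu, B₁, ⟨hB₁, huB₁⟩, hbB₁⟩ := hb
    obtain ⟨hcC, hcu, B₂, ⟨hB₂, huB₂⟩, hcB₂⟩ := hc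
    by_contra hbc
    have hB : B₁ ≠ B₂ := by
      rintro rfl
      exact hbc (hthree B₁ hB₁ huB₁ b hbB₁ c hcB₂ hbu.symm hcu.symm)
    obtain rfl : B₁ = C :=
      h.eq_of_triangle hB₁ hB₂ hC hbu.symm hbc huB₁ huB₂ hbB₁ hbC hcB₂ hcC hB
    exact hbc (hthree B₁ hB₁ huB₁ b hbC c hcC hbu.symm hcu.symm)
  subset_union C hC x hxC hx y hyC := by
    obtain rfl := mem_singleton.1 hx
    by_cases hyx : y = x
    · simp [hyx]
    · exact mem_union_right _ (mem_erase.2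
        ⟨hyx, mem_biUnion.2 ⟨C, mem_filter.2 ⟨hC, hxC⟩, hyC⟩⟩)

lemma IsStableSide.of_contract (hA : IsStableSide (contract u q 𝓒) A S) (hu : u ∈ A) :
    IsStableSide 𝓒 (insert q A) (S.erase q) where
  disjoint := by
    rw [disjoint_insert_left]
    exact ⟨notMem_erase _ _, hA.disjoint.mono_right (erase_subset _ _)⟩
  card_inter_le_one C hC := by
    refine (card_le_card ?_).trans (hA.card_inter_le_one _ (merge_mem_contract u q hC))
    rw [inter_erase, ← erase_inter]
    exact inter_subset_inter_right (erase_subset_merge u q C)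
  subset_union C hC x hxC hx := by
    have hmerge : merge u q C ⊆ A ∪ S := by
      by_cases hq : q ∈ C
      · exact hA.subset_union _ (merge_mem_contract u q hC) u (mem_merge_of_mem u hq) hu
      · have hxq : x ≠ q := ne_of_mem_of_not_mem hxC hq
        exact hA.subset_union _ (merge_mem_contract u q hC) x
          (erase_subset_merge u q C (mem_erase.2 ⟨hxq, hxC⟩)) (mem_of_mem_insert_of_ne hx hxq)
    intro y hyC
    by_cases hyq : y = q
    · simp [hyq]
    · have hy := hmerge (erase_subset_merge u q C (mem_erase.2 ⟨hyq, hyC⟩))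
      simpa [hyq] using hy

section Components

variable [Finite V]

lemma IsStableSide.of_components (hs : IsSparse 𝓒) (hA : IsStableSide (components 𝓒) A S) :
    IsStableSide 𝓒 A S where
  disjoint := hA.disjoint
  card_inter_le_one C hC := by
    by_cases hC2 : 2 ≤ #C
    · obtain ⟨R, hR, hCR⟩ :=
        (hs.isTight_of_subset_mem hC hC2 subset_rfl).exists_mem_components
      exact (card_le_card (inter_subset_inter_right hCR)).trans (hA.card_inter_le_one R hR)
    · exact (card_le_card inter_subset_left).trans (by omega)
  subset_union C hC x hxC hx := by
    by_cases hC2 : 2 ≤ #C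
    · obtain ⟨R, hR, hCR⟩ :=
        (hs.isTight_of_subset_mem hC hC2 subset_rfl).exists_mem_components
      exact hCR.trans (hA.subset_union R hR x (hCR hxC) hx)
    · intro y hy
      rw [card_le_one.1 (by omega) y hy x hxC]
      exact mem_union_left _ hx

lemma IsTight.components (hs : IsSparse 𝓒) (hX : IsTight 𝓒 X) : IsTight (components 𝓒) X :=
  have ⟨_, hR, hXR⟩ := hX.exists_mem_components
  hs.isSaturated_components.sparse.isTight_of_subset_mem hR hX.1 hXR

lemma IsJoined.of_components (hs : IsSparse 𝓒) (h : IsJoined (components 𝓒) u D) :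
    IsJoined 𝓒 u D :=
  have ⟨T, hT, huT, hDT⟩ := h
  have ⟨R, hR, hTR⟩ := hs.isSaturated_components.exists_superset T hT
  ⟨R, (mem_components.1 hR).1, hTR huT, hDT.trans hTR⟩

lemma biUnion_contract_components_ssubset (hs : IsSparse 𝓒) (hQ : Q ∈ components 𝓒)
    (hu : u ∈ Q) (hq : q ∈ Q) (huq : u ≠ q) :
    (contract u q (components 𝓒)).biUnion id ⊂ 𝓒.biUnion id := by
  have hsub : ∀ R ∈ components 𝓒, R ⊆ 𝓒.biUnion id := fun R hR =>
    (mem_components.1 hR).1.subset_biUnion hs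
  refine (ssubset_iff_of_subset ?_).2 ⟨q, hsub Q hQ hq, notMem_biUnion_contract huq _⟩
  refine biUnion_subset.2 fun C hC => ?_
  obtain ⟨R, hR, rfl⟩ := mem_image.1 hC
  exact (merge_subset_insert u q R).trans (insert_subset (hsub Q hQ hu) (hsub R hR))

theorem IsSparse.exists_isStableSide (hs : IsSparse 𝓒) (hDt : IsTight 𝓒 D)
    (hD : ¬ IsJoined 𝓒 u D) : ∃ A S, IsStableSide 𝓒 A S ∧ u ∈ A ∧ Disjoint D A := by
  induction hN : 𝓒.biUnion id using Finset.strongInduction generalizing 𝓒 with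
  | H N ih =>
    subst hN
    have hsat := hs.isSaturated_components
    have hDt' := hDt.components hs
    have hD' : ¬ IsJoined (components 𝓒) u D := fun h => hD (h.of_components hs)
    suffices ∃ A S, IsStableSide (components 𝓒) A S ∧ u ∈ A ∧ Disjoint D A from
      have ⟨A, S, hAS, huA, hDA⟩ := this
      ⟨A, S, hAS.of_components hs, huA, hDA⟩
    by_cases hlarge : ∃ Q ∈ components 𝓒, u ∈ Q ∧ 3 ≤ #Q
    · obtain ⟨Q, hQ, huQ, hQ3⟩ := hlarge
      obtain ⟨q, hqQ, huq, hqD, hj⟩ := hsat.exists_not_isJoined_contract hQ huQ hQ3 hDt' hD'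
      have hs' := hsat.isSparse_contract hQ huQ hqQ huq
      have hDt'' : IsTight (contract u q (components 𝓒)) D := by
        obtain ⟨R, hR, hDR⟩ := hDt.exists_mem_components
        refine hs'.isTight_of_subset_mem (merge_mem_contract u q hR) hDt.1 ?_
        exact (subset_erase.2 ⟨hDR, hqD⟩).trans (erase_subset_merge u q R)
      obtain ⟨A, S, hAS, huA, hDA⟩ := ih _
        (biUnion_contract_components_ssubset hs hQ huQ hqQ huq) hs' hDt'' hj rfl
      exact ⟨insert q A, S.erase q, hAS.of_contract huA, mem_insert_of_mem huA,
        disjoint_insert_right.2 ⟨hqD, hDA⟩⟩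
    · push Not at hlarge
      have huD : u ∉ D := fun hu => hD ⟨D, hDt, hu, subset_rfl⟩
      exact ⟨{u}, _, hsat.isStableSide_singleton hlarge, mem_singleton_self u,
        disjoint_singleton_right.2 huD⟩

end Components

end Contraction

section Genericity

open MvPolynomial

variable {W : Type*} {p q : W → Plane} {a b c : W}

/-- The cross product of two vectors of the plane: it vanishes exactly on dependent pairs. -/
def cross (x y : Plane) : ℝ := x 0 * y 1 - x 1 * y 0

lemma linearIndependent_pair_of_cross_ne_zero {x y : Plane} (h : cross x y ≠ 0) :
    LinearIndependent ℝ ![x, y] := by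
  refine LinearIndependent.pair_iff.2 fun s t hst => ?_
  have h0 : s * x 0 + t * y 0 = 0 := by simpa using congr($hst 0)
  have h1 : s * x 1 + t * y 1 = 0 := by simpa using congr($hst 1)
  unfold cross at h
  exact ⟨(mul_eq_zero.1 (by linear_combination y 1 * h0 - y 0 * h1)).resolve_right h,
    (mul_eq_zero.1 (by linear_combination x 0 * h1 - x 1 * h0)).resolve_right h⟩

lemma IsGeneric.injective (hp : IsGeneric p) : Function.Injective p := fun a b hab =>
  congrArg Prod.fst
    (AlgebraicIndependent.injective hp (a₁ := (a, 0)) (a₂ := (b, 0)) (by simp [hab]))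

lemma IsGeneric.aeval_ne_zero (hp : IsGeneric p) {P : MvPolynomial (W × Fin 2) ℚ}
    {x : W × Fin 2 → ℝ} (hx : aeval x P ≠ 0) : aeval (fun a => p a.1 a.2) P ≠ 0 := fun h =>
  hx (by rw [algebraicIndependent_iff.1 hp P h, map_zero])

lemma IsGeneric.cross_ne_zero (hp : IsGeneric p) (hab : a ≠ b) (hac : a ≠ c) (hbc : b ≠ c) :
    cross (p b - p a) (p c - p a) ≠ 0 := by
  classical
  let P : MvPolynomial (W × Fin 2) ℚ :=
    (X (b, 0) - X (a, 0)) * (X (c, 1) - X (a, 1)) - (X (b, 1) - X (a, 1)) * (X (c, 0) - X (a, 0))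
  have h := hp.aeval_ne_zero (P := P) (x := fun y => if y = (b, 0) ∨ y = (c, 1) then 1 else 0)
    (by simp [P, hab, hac, hbc, hbc.symm])
  simpa [P, cross] using h

end Genericity

section Independence

open Finset Matrix

variable {W : Type*} [DecidableEq W] {E F : Finset (Finset W)} {p q : W → Plane} {e : Finset W}
  {a b v w : W}

/-- The row of the rigidity matrix of the realisation `p` at the edge `e = {a, b}`: its entry is
`p a - p b` at `a`, `p b - p a` at `b`, and zero at the other vertices. -/
noncomputable def rigidityRow (p : W → Plane) (e : Finset W) : PiLp 2 fun _ : W => Plane :=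
  WithLp.toLp 2 fun w => if w ∈ e then ∑ x ∈ e, (p w - p x) else 0

/-- The framework with edge set `E` and realisation `p` is independent: it has no nonzero
self-stress. -/
def Independent (E : Finset (Finset W)) (p : W → Plane) : Prop :=
  LinearIndepOn ℝ (rigidityRow p) (E : Set (Finset W))

lemma rigidityRow_apply_of_notMem (p : W → Plane) (h : w ∉ e) : rigidityRow p e w = 0 :=
  if_neg h

lemma rigidityRow_pair_left (p : W → Plane) (h : a ≠ b) :
    rigidityRow p {a, b} a = p a - p b := by
  simp [rigidityRow, sum_pair h]

lemma rigidityRow_pair_right (p : W → Plane) (h : a ≠ b) :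
    rigidityRow p {a, b} b = p b - p a := by
  rw [pair_comm, rigidityRow_pair_left p h.symm]

lemma Independent.ne (h : Independent E p) (he : {a, b} ∈ E) : p a ≠ p b := by
  intro hab
  have eq_left : ∀ x ∈ ({a, b} : Finset W), p x = p a := by simp [hab]
  refine h.ne_zero he (PiLp.ext fun w => ite_eq_right_iff.2 fun hw => sum_eq_zero fun x hx => ?_)
  rw [eq_left w hw, eq_left x hx, sub_self]

section Gram

variable [Fintype W]

lemma inner_rigidityRow (p : W → Plane) (e f : Finset W) :
    inner ℝ (rigidityRow p e) (rigidityRow p f) =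
      ∑ w ∈ e ∩ f, ∑ x ∈ e, ∑ y ∈ f, inner ℝ (p w - p x) (p w - p y) := by
  rw [PiLp.inner_apply, ← sum_subset (subset_univ (e ∩ f)) fun w _ hw => ?_]
  · refine sum_congr rfl fun w hw => ?_
    simp only [rigidityRow, mem_of_mem_inter_left hw, mem_of_mem_inter_right hw, if_true,
      sum_inner, inner_sum]
    exact sum_comm
  · simp only [rigidityRow, mem_inter, not_and] at hw ⊢
    split_ifs <;> simp_all

lemma independent_iff_det_gram :
    Independent E p ↔ (gram ℝ fun e : E => rigidityRow p e).det ≠ 0 :=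
  det_gram_ne_zero_iff_linearIndependent.symm

open MvPolynomial in
lemma exists_aeval_eq_det_gram (E : Finset (Finset W)) :
    ∃ P : MvPolynomial (W × Fin 2) ℚ, ∀ p : W → Plane,
      aeval (fun a => p a.1 a.2) P = (gram ℝ fun e : E => rigidityRow p e).det := by
  let A : Matrix E E (MvPolynomial (W × Fin 2) ℚ) := fun e f =>
    ∑ w ∈ e.1 ∩ f, ∑ x ∈ e.1, ∑ y ∈ f.1, ∑ i, (X (w, i) - X (x, i)) * (X (w, i) - X (y, i))
  refine ⟨A.det, fun p => ?_⟩
  rw [AlgHom.map_det]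
  congr 1
  ext e f
  rw [gram_apply, inner_rigidityRow, AlgHom.mapMatrix_apply, map_apply]
  simp [A, PiLp.inner_apply, mul_comm]

end Gram

variable [Finite W]

lemma isOpen_independent (E : Finset (Finset W)) : IsOpen {p : W → Plane | Independent E p} := by
  cases nonempty_fintype W
  simp only [independent_iff_det_gram]
  refine isOpen_ne_fun (Continuous.matrix_det (continuous_matrix fun e f => ?_)) continuous_const
  simp only [gram_apply, inner_rigidityRow]
  fun_prop

lemma Independent.congr (h : Independent E p) (hpq : Congruent p q) : Independent E q := by
  cases nonempty_fintype W
  have inner_eq : ∀ w x y, inner ℝ (q w - q x) (q w - q y) = inner ℝ (p w - p x) (p w - p y) := by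
    intro w x y
    simp only [real_inner_eq_norm_mul_self_add_norm_mul_self_sub_norm_sub_mul_self_div_two,
      sub_sub_sub_cancel_left, ← dist_eq_norm, hpq.dist_eq]
  rw [independent_iff_det_gram] at h ⊢
  convert h using 2
  ext e f
  simp only [gram_apply, inner_rigidityRow, inner_eq]

lemma IsGeneric.independent (hp : IsGeneric p) (hq : Independent E q) : Independent E p := by
  cases nonempty_fintype W
  obtain ⟨P, hP⟩ := exists_aeval_eq_det_gram E
  rw [independent_iff_det_gram, ← hP] at hq ⊢
  exact hp.aeval_ne_zero hq

end Independence

section EdgeSets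

open Finset

variable {W : Type*} [DecidableEq W] {E : Finset (Finset W)} {R X e : Finset W} {a b c v : W}

lemma spread_eq_card_filter (hE : ∀ e ∈ E, #e = 2) (X : Finset W) :
    spread E X = #(E.filter (· ⊆ X)) := by
  rw [card_filter, spread]
  refine sum_congr rfl fun e he => ?_
  have hcard := hE e he
  split_ifs with heX
  · rw [inter_eq_left.2 heX, hcard]
  · have := card_lt_card (inter_subset_left.ssubset_of_ne (mt inter_eq_left.1 heX))
    omega

lemma exists_eq_pair_of_mem (he : #e = 2) (hv : v ∈ e) : ∃ x, v ≠ x ∧ e = {v, x} := by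
  obtain ⟨x, hx⟩ := card_eq_one.1 (show #(e.erase v) = 1 by rw [card_erase_of_mem hv, he])
  exact ⟨x, (ne_of_mem_erase (hx ▸ mem_singleton_self x)).symm, by rw [← hx, insert_erase hv]⟩

lemma IsSparse.insert_pair_or (hs : IsSparse E) (hab : a ≠ b) :
    ({a, b} ∉ E ∧ IsSparse (insert {a, b} E)) ∨ ∃ T, IsTight E T ∧ a ∈ T ∧ b ∈ T := by
  by_cases hmem : {a, b} ∈ E
  · exact .inr ⟨_, hs.isTight_of_subset_mem hmem (card_pair hab).ge subset_rfl, by simp, by simp⟩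
  by_cases hinsert : IsSparse (insert {a, b} E)
  · exact .inl ⟨hmem, hinsert⟩
  obtain ⟨X, hX, hlt⟩ : ∃ X, 2 ≤ #X ∧ 2 * #X < spread (insert {a, b} E) X + 3 := by
    simpa [IsSparse] using hinsert
  rw [spread, sum_insert hmem, ← spread] at hlt
  have hle : #({a, b} ∩ X) ≤ #{a, b} := card_le_card inter_subset_left
  rw [card_pair hab] at hle
  have hX_sparse := hs X hX
  have hsub : {a, b} ⊆ X :=
    inter_eq_left.1 (eq_of_subset_of_card_le inter_subset_left (by rw [card_pair hab]; omega))
  exact .inr ⟨X, hs.isTight_of_le hX (by omega), hsub (by simp), hsub (by simp)⟩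

lemma IsSparse.card_filter_mem_le_two (hs : IsSparse E) (hE : ∀ e ∈ E, #e = 2)
    (hR : IsTight (E.filter (v ∉ ·)) R) (h : ∀ e ∈ E, v ∈ e → e ⊆ insert v R) :
    #(E.filter (v ∈ ·)) ≤ 2 := by
  have hsum : spread E (insert v R) =
      spread (E.filter (v ∈ ·)) (insert v R) + spread (E.filter (v ∉ ·)) (insert v R) :=
    (sum_filter_add_sum_filter_not E (v ∈ ·) _).symm
  have hstar : spread (E.filter (v ∈ ·)) (insert v R) = #(E.filter (v ∈ ·)) := by
    rw [spread_eq_card_filter fun e he => hE e (mem_filter.1 he).1, filter_filter]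
    exact congrArg card (filter_congr fun e he => and_iff_left_of_imp (h e he))
  have hmono := spread_mono_right (E.filter (v ∉ ·)) (subset_insert v R)
  have hcard := card_insert_le v R
  have hbound := hs (insert v R) (hR.1.trans (card_le_card (subset_insert v R)))
  have := hR.2
  omega

lemma IsSparse.exists_card_filter_mem_le_three (hs : IsSparse E) (hE : ∀ e ∈ E, #e = 2)
    (hne : E.Nonempty) : ∃ v ∈ E.biUnion id, #(E.filter (v ∈ ·)) ≤ 3 := by
  by_contra! hdeg
  set U := E.biUnion id
  have hsub : ∀ e ∈ E, e ⊆ U := fun e he => subset_biUnion_of_mem id he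
  have hcount : #U * 4 ≤ ∑ e ∈ E, 2 := (le_sum_card_inter hdeg).trans_eq
    (sum_congr rfl fun e he => by rw [inter_eq_right.2 (hsub e he), hE e he])
  have hspread : spread E U = #E := by
    rw [spread_eq_card_filter hE, filter_true_of_mem hsub]
  obtain ⟨e, he⟩ := hne
  have hbound := hs U ((hE e he).ge.trans (card_le_card (hsub e he)))
  rw [sum_const, smul_eq_mul] at hcount
  omega

variable [Finite W]

lemma IsSparse.exists_isTight_of_triangle (hs : IsSparse E) (hab : a ≠ b) (hbc : b ≠ c)
    (h₁ : ∃ T, IsTight E T ∧ a ∈ T ∧ b ∈ T) (h₂ : ∃ T, IsTight E T ∧ a ∈ T ∧ c ∈ T)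
    (h₃ : ∃ T, IsTight E T ∧ b ∈ T ∧ c ∈ T) : ∃ T, IsTight E T ∧ a ∈ T ∧ b ∈ T ∧ c ∈ T := by
  have exists_component : ∀ {x y : W}, (∃ T, IsTight E T ∧ x ∈ T ∧ y ∈ T) →
      ∃ R ∈ components E, x ∈ R ∧ y ∈ R := fun ⟨T, hT, hx, hy⟩ =>
    let ⟨R, hR, hTR⟩ := hT.exists_mem_components
    ⟨R, hR, hTR hx, hTR hy⟩
  obtain ⟨R₁, hR₁, ha₁, hb₁⟩ := exists_component h₁
  obtain ⟨R₂, hR₂, ha₂, hc₂⟩ := exists_component h₂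
  obtain ⟨R₃, hR₃, hb₃, hc₃⟩ := exists_component h₃
  refine ⟨R₁, (mem_components.1 hR₁).1, ha₁, hb₁, ?_⟩
  by_cases h : R₁ = R₂
  · exact h ▸ hc₂
  · exact hs.isSaturated_components.eq_of_triangle hR₁ hR₂ hR₃ hab hbc ha₁ ha₂ hb₁ hb₃ hc₂ hc₃ h ▸
      hc₃

lemma IsSparse.exists_reduction (hs : IsSparse E) (hE : ∀ e ∈ E, #e = 2)
    (hv : #(E.filter (v ∈ ·)) = 3) :
    ∃ a b c, v ∉ ({a, b, c} : Finset W) ∧ a ≠ b ∧ a ≠ c ∧ b ≠ c ∧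
      E.filter (v ∈ ·) = {{v, a}, {v, b}, {v, c}} ∧
      {a, b} ∉ E.filter (v ∉ ·) ∧ IsSparse (insert {a, b} (E.filter (v ∉ ·))) := by
  obtain ⟨e, f, g, hef, heg, hfg, hstar⟩ := card_eq_three.1 hv
  have mem_star : ∀ x ∈ ({e, f, g} : Finset (Finset W)), x ∈ E ∧ v ∈ x := fun x hx =>
    mem_filter.1 (hstar ▸ hx)
  have exists_eq : ∀ x ∈ ({e, f, g} : Finset (Finset W)), ∃ y, v ≠ y ∧ x = {v, y} := fun x hx =>
    exists_eq_pair_of_mem (hE x (mem_star x hx).1) (mem_star x hx).2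
  obtain ⟨a, hva, rfl⟩ := exists_eq e (by simp)
  obtain ⟨b, hvb, rfl⟩ := exists_eq f (by simp)
  obtain ⟨c, hvc, rfl⟩ := exists_eq g (by simp)
  have hab : a ≠ b := by rintro rfl; exact hef rfl
  have hac : a ≠ c := by rintro rfl; exact heg rfl
  have hbc : b ≠ c := by rintro rfl; exact hfg rfl
  have hsF : IsSparse (E.filter (v ∉ ·)) := hs.mono (filter_subset _ _)
  obtain h₁ | h₁ := hsF.insert_pair_or hab
  · exact ⟨a, b, c, by simp [*], hab, hac, hbc, hstar, h₁⟩
  obtain h₂ | h₂ := hsF.insert_pair_or hac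
  · refine ⟨a, c, b, by simp [*], hac, hab, hbc.symm, hstar.trans ?_, h₂⟩
    rw [pair_comm ({v, b} : Finset W)]
  obtain h₃ | h₃ := hsF.insert_pair_or hbc
  · refine ⟨b, c, a, by simp [*], hbc, hab.symm, hac.symm, ?_, h₃⟩
    rw [hstar, insert_comm, pair_comm ({v, a} : Finset W)]
  obtain ⟨T, hT, haT, hbT, hcT⟩ := hsF.exists_isTight_of_triangle hab hbc h₁ h₂ h₃
  have hle := hs.card_filter_mem_le_two hE hT fun e he hve => by
    have : e ∈ ({{v, a}, {v, b}, {v, c}} : Finset (Finset W)) :=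
      hstar ▸ mem_filter.2 ⟨he, hve⟩
    simp only [mem_insert, mem_singleton] at this
    rcases this with rfl | rfl | rfl <;> simp [insert_subset_iff, *]
  omega

end EdgeSets

section Henneberg

open Finset

variable {W : Type*} [DecidableEq W] {E F : Finset (Finset W)} {p : W → Plane} {e : Finset W}
  {a b c v : W}

lemma Independent.of_vertex (hF : Independent (E.filter (v ∉ ·)) p)
    (hv : LinearIndepOn ℝ (fun e => rigidityRow p e v) (E.filter (v ∈ ·) : Set (Finset W))) :
    Independent E p := by
  refine linearIndepOn_finset_iff.2 fun l hl => ?_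
  have hl_star : ∀ e ∈ E.filter (v ∈ ·), l e = 0 := by
    refine linearIndepOn_finset_iff.1 hv l ?_
    rw [sum_filter_of_ne fun e _ hne => ?_]
    · simpa [WithLp.ofLp_sum] using congr($hl v)
    · contrapose! hne
      rw [rigidityRow_apply_of_notMem p hne, smul_zero]
  have hl_rest : ∀ e ∈ E.filter (v ∉ ·), l e = 0 := by
    refine linearIndepOn_finset_iff.1 hF l ?_
    rwa [sum_filter_of_ne fun e he hne => ?_]
    exact fun hve => hne (by rw [hl_star e (mem_filter.2 ⟨he, hve⟩), zero_smul])
  intro e he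
  by_cases hve : v ∈ e
  · exact hl_star e (mem_filter.2 ⟨he, hve⟩)
  · exact hl_rest e (mem_filter.2 ⟨he, hve⟩)

lemma linearIndepOn_pair_rigidityRow (hva : v ≠ a) (hvb : v ≠ b)
    (h : cross (p v - p a) (p v - p b) ≠ 0) :
    LinearIndepOn ℝ (fun e => rigidityRow p e v) {{v, a}, {v, b}} := by
  have hne : ({v, a} : Finset W) ≠ {v, b} := fun hab => by
    have : a ∈ ({v, b} : Finset W) := hab ▸ by simp
    obtain rfl : a = b := by simpa [hva.symm] using this
    exact h (by simp [cross, mul_comm])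
  rw [LinearIndepOn.pair_iff _ hne]
  simpa only [rigidityRow_pair_left p hva, rigidityRow_pair_left p hvb] using
    LinearIndependent.pair_iff.1 (linearIndependent_pair_of_cross_ne_zero h)

lemma rigidityRow_update (hv : v ∉ e) (x : Plane) :
    rigidityRow (Function.update p v x) e = rigidityRow p e := by
  have update_eq : ∀ w ∈ e, Function.update p v x w = p w := fun w hw =>
    Function.update_of_ne (ne_of_mem_of_not_mem hw hv) x p
  ext1 w
  refine ite_congr rfl (fun hw => sum_congr rfl fun y hy => ?_) fun _ => rfl
  rw [update_eq w hw, update_eq y hy]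

lemma rigidityRow_add_rigidityRow_of_midpoint (hva : v ≠ a) (hvb : v ≠ b) (hab : a ≠ b)
    (hv : p v = midpoint ℝ (p a) (p b)) :
    (2 : ℝ) • (rigidityRow p {v, a} + rigidityRow p {v, b}) = rigidityRow p {a, b} := by
  have hmid : p v + p v = p a + p b := by rw [hv, midpoint_add_self]
  ext1 w
  by_cases hw : w ∈ ({v, a, b} : Finset W)
  · simp only [mem_insert, mem_singleton] at hw
    simp only [PiLp.smul_apply, PiLp.add_apply]
    rcases hw with rfl | rfl | rfl
    · rw [rigidityRow_pair_left p hva, rigidityRow_pair_left p hvb,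
        rigidityRow_apply_of_notMem p (by simp [hva, hvb])]
      linear_combination (norm := module) (2 : ℝ) • hmid
    · rw [rigidityRow_pair_right p hva, rigidityRow_pair_left p hab,
        rigidityRow_apply_of_notMem p (by simp [hva.symm, hab])]
      linear_combination (norm := module) (-1 : ℝ) • hmid
    · rw [rigidityRow_pair_right p hvb, rigidityRow_pair_right p hab,
        rigidityRow_apply_of_notMem p (by simp [hvb.symm, hab.symm])]
      linear_combination (norm := module) (-1 : ℝ) • hmid
  · simp_all [rigidityRow_apply_of_notMem]

/-- The new vertex is put at the midpoint of `a` and `b`, where the edge `ab` can be exchanged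
for one of the two halves into which the vertex divides it. -/
lemma Independent.one_extension (hv : v ∉ ({a, b, c} : Finset W)) (hab : a ≠ b)
    (hFv : ∀ e ∈ F, v ∉ e) (habF : {a, b} ∉ F) (hF : Independent (insert {a, b} F) p)
    (hcross : cross (p b - p a) (p c - p a) ≠ 0) :
    Independent ({{v, a}, {v, b}, {v, c}} ∪ F) (Function.update p v (midpoint ℝ (p a) (p b))) := by
  rw [insert_comm ({v, a} : Finset W), insert_union, insert_union, singleton_union]
  simp only [mem_insert, mem_singleton, not_or] at hv
  obtain ⟨hva, hvb, hvc⟩ := hv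
  set q := Function.update p v (midpoint ℝ (p a) (p b)) with hq
  have q_eq : ∀ x, v ≠ x → q x = p x := fun x hx => Function.update_of_ne hx.symm _ p
  have hqv : q v = midpoint ℝ (q a) (q b) := by
    rw [q_eq a hva, q_eq b hvb, hq, Function.update_self]
  have hab_v : v ∉ ({a, b} : Finset W) := by simp [hva, hvb]
  have hab_ne : ∀ x, ({a, b} : Finset W) ≠ {v, x} := fun x h => hab_v (h ▸ mem_insert_self v {x})
  have hFq : Independent (insert {a, b} F) q := (linearIndepOn_congr fun e he => by
    refine rigidityRow_update ?_ _
    rcases mem_insert.1 (mem_coe.1 he) with rfl | heF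
    exacts [hab_v, hFv e heF]).2 hF
  have hq_cross : cross (q v - q a) (q v - q c) ≠ 0 := by
    have hmid : q v + q v = q a + q b := by rw [hqv, midpoint_add_self]
    have h0 : q v 0 + q v 0 = q a 0 + q b 0 := congr($hmid 0)
    have h1 : q v 1 + q v 1 = q a 1 + q b 1 := congr($hmid 1)
    rw [← q_eq a hva, ← q_eq b hvb, ← q_eq c hvc] at hcross
    contrapose! hcross
    simp only [cross, PiLp.sub_apply] at hcross ⊢
    linear_combination (q a 1 - q c 1) * h0 + (q c 0 - q a 0) * h1 - 2 * hcross
  have hindep : Independent (insert {a, b} (insert {v, a} (insert {v, c} F))) q := by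
    refine Independent.of_vertex (v := v) ?_ ?_
    · simpa [filter_insert, hab_v, filter_true_of_mem hFv] using hFq
    · simpa [filter_insert, hab_v, filter_false_of_mem (p := (v ∈ ·)) hFv] using
        linearIndepOn_pair_rigidityRow hva hvc hq_cross
  rw [Independent, coe_insert, linearIndepOn_insert (by simp [hab_ne, habF])] at hindep
  rw [Independent, coe_insert]
  refine hindep.1.insert fun hvb_mem => hindep.2 ?_
  rw [← rigidityRow_add_rigidityRow_of_midpoint hva hvb hab hqv]
  exact Submodule.smul_mem _ _
    (add_mem (Submodule.subset_span ⟨{v, a}, by simp, rfl⟩) hvb_mem)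

lemma IsGeneric.independent_of_card_le_two (hp : IsGeneric p) (hE : ∀ e ∈ E, #e = 2)
    (hv : #(E.filter (v ∈ ·)) ≤ 2) (hF : Independent (E.filter (v ∉ ·)) p) :
    Independent E p := by
  refine hF.of_vertex ?_
  have exists_eq : ∀ e ∈ E.filter (v ∈ ·), ∃ x, v ≠ x ∧ e = {v, x} := fun e he =>
    exists_eq_pair_of_mem (hE e (mem_filter.1 he).1) (mem_filter.1 he).2
  interval_cases hcard : #(E.filter (v ∈ ·))
  · simp [card_eq_zero.1 hcard]
  · obtain ⟨e, hstar⟩ := card_eq_one.1 hcard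
    obtain ⟨a, hva, rfl⟩ := exists_eq e (by simp [hstar])
    rw [hstar, coe_singleton]
    refine .singleton ?_
    rw [rigidityRow_pair_left p hva]
    exact sub_ne_zero.2 (hp.injective.ne hva)
  · obtain ⟨e, f, hef, hstar⟩ := card_eq_two.1 hcard
    obtain ⟨a, hva, rfl⟩ := exists_eq e (by simp [hstar])
    obtain ⟨b, hvb, rfl⟩ := exists_eq f (by simp [hstar])
    rw [hstar, coe_pair]
    refine linearIndepOn_pair_rigidityRow hva hvb ?_
    have hab : a ≠ b := by rintro rfl; exact hef rfl
    convert hp.cross_ne_zero hva hvb hab using 1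
    simp only [cross, PiLp.sub_apply]
    ring

/-- The induction is Henneberg's: a sparse edge set has a vertex of degree at most three. -/
theorem IsSparse.independent [Finite W] (hs : IsSparse E) (hE : ∀ e ∈ E, #e = 2)
    (hp : IsGeneric p) : Independent E p := by
  obtain ⟨U, hU⟩ : ∃ U, ∀ e ∈ E, e ⊆ U := ⟨_, fun e he => subset_biUnion_of_mem id he⟩
  induction U using Finset.strongInduction generalizing E with
  | H U ih =>
  obtain rfl | hne := E.eq_empty_or_nonempty
  · simp [Independent]
  obtain ⟨v, hvE, hdeg⟩ := hs.exists_card_filter_mem_le_three hE hne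
  obtain ⟨e₀, he₀, hve₀⟩ := mem_biUnion.1 hvE
  have hvU : U.erase v ⊂ U := erase_ssubset (hU e₀ he₀ hve₀)
  have hFU : ∀ e ∈ E.filter (v ∉ ·), e ⊆ U.erase v := fun e he =>
    subset_erase.2 ⟨hU e (mem_filter.1 he).1, (mem_filter.1 he).2⟩
  have hFE : ∀ e ∈ E.filter (v ∉ ·), #e = 2 := fun e he => hE e (mem_filter.1 he).1
  obtain hdeg | hdeg := hdeg.lt_or_eq
  · exact hp.independent_of_card_le_two hE (Nat.lt_succ_iff.1 hdeg)
      (ih _ hvU (hs.mono (filter_subset _ _)) hFE hFU)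
  obtain ⟨a, b, c, hv, hab, hac, hbc, hstar, habF, hsF⟩ := hs.exists_reduction hE hdeg
  have hab_card : #{a, b} = 2 := card_pair hab
  have habU : {a, b} ⊆ U.erase v := by
    have mem_star : ∀ x ∈ ({a, b} : Finset W), {v, x} ∈ E := fun x hx => by
      refine (mem_filter.1 (hstar ▸ ?_ : {v, x} ∈ E.filter (v ∈ ·))).1
      obtain rfl | rfl := by simpa using hx
      all_goals simp
    exact fun x hx => mem_erase.2 ⟨by rintro rfl; simp_all, hU _ (mem_star x hx) (by simp)⟩
  have hF := ih _ hvU hsF (forall_mem_insert _ _ _ |>.2 ⟨hab_card, hFE⟩)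
    (forall_mem_insert _ _ _ |>.2 ⟨habU, hFU⟩)
  have hext := hF.one_extension hv hab (fun e he => (mem_filter.1 he).2) habF
    (hp.cross_ne_zero hab hac hbc)
  rw [← hstar, filter_union_filter_not_eq] at hext
  exact hp.independent hext

end Henneberg

section InfinitesimalRigidity

open Finset

variable {W : Type*} {E : Finset (Finset W)} {p q y : W → Plane} {a b c d : W}

/-- The infinitesimal isometry with translation part `r.1` and angular velocity `r.2`. -/
noncomputable def infinitesimalIsometry (p : W → Plane) :
    Plane × ℝ →ₗ[ℝ] PiLp 2 fun _ : W => Plane where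
  toFun r := WithLp.toLp 2 fun w => r.1 + r.2 • !₂[-p w 1, p w 0]
  map_add' r s := by ext w : 1; simp; module
  map_smul' t r := by ext w : 1; simp; module

lemma inner_infinitesimalIsometry (p : W → Plane) (r : Plane × ℝ) (a b : W) :
    inner ℝ (p a - p b) (infinitesimalIsometry p r a - infinitesimalIsometry p r b) = 0 := by
  simp [infinitesimalIsometry, PiLp.inner_apply]
  ring

lemma infinitesimalIsometry_injective (h : p c ≠ p d) :
    Function.Injective (infinitesimalIsometry p) := by
  refine (injective_iff_map_eq_zero _).2 fun r hr => ?_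
  have apply_eq_zero : ∀ w, r.1 + r.2 • !₂[-p w 1, p w 0] = 0 := fun w => congr($hr w)
  have angular_eq_zero : r.2 = 0 := by
    by_contra hne
    have heq := smul_right_injective _ hne
      (add_left_cancel ((apply_eq_zero c).trans (apply_eq_zero d).symm))
    have h0 : p c 0 = p d 0 := by simpa using congr($heq 1)
    have h1 : p c 1 = p d 1 := by simpa using congr($heq 0)
    exact h (by ext i; fin_cases i; exacts [h0, h1])
  have translation_eq_zero : r.1 = 0 := by simpa [angular_eq_zero] using apply_eq_zero c
  exact Prod.ext translation_eq_zero angular_eq_zero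

variable [Fintype W] [DecidableEq W]

lemma inner_rigidityRow_pair (p y : W → Plane) (hab : a ≠ b) :
    inner ℝ (rigidityRow p {a, b}) (WithLp.toLp 2 y) = inner ℝ (p a - p b) (y a - y b) := by
  rw [PiLp.inner_apply, ← sum_subset (subset_univ {a, b}), sum_pair hab,
    rigidityRow_pair_left p hab, rigidityRow_pair_right p hab, ← neg_sub (p a) (p b),
    inner_neg_left, ← sub_eq_add_neg, ← inner_sub_right]
  exact fun w _ hw => by rw [rigidityRow_apply_of_notMem p hw, inner_zero_left]

lemma mem_orthogonal_span_rigidityRow (hE : ∀ e ∈ E, #e = 2)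
    (hy : ∀ a b, {a, b} ∈ E → inner ℝ (p a - p b) (y a - y b) = 0) :
    WithLp.toLp 2 y ∈ (Submodule.span ℝ (rigidityRow p '' E))ᗮ := by
  refine Submodule.mem_orthogonal _ _ |>.2 fun u hu => ?_
  induction hu using Submodule.span_induction with
  | mem x hx =>
    obtain ⟨e, he, rfl⟩ := hx
    obtain ⟨a, b, hab, rfl⟩ := card_eq_two.1 (hE e he)
    rw [inner_rigidityRow_pair p y hab, hy a b he]
  | zero => exact inner_zero_left _
  | add u v _ _ hu hv => rw [inner_add_left, hu, hv, add_zero]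
  | smul r u _ hu => rw [inner_smul_left, hu, mul_zero]

lemma Independent.finrank_orthogonal_span (hp : Independent E p) :
    #E + Module.finrank ℝ (Submodule.span ℝ (rigidityRow p '' E))ᗮ = 2 * Fintype.card W := by
  have hspan : Module.finrank ℝ (Submodule.span ℝ (rigidityRow p '' E)) = #E := by
    rw [Set.image_eq_range, finrank_span_eq_card hp]
    exact Fintype.card_coe E
  have hspace : Module.finrank ℝ (PiLp 2 fun _ : W => Plane) = 2 * Fintype.card W := by
    rw [(WithLp.linearEquiv 2 ℝ (W → Plane)).finrank_eq, Module.finrank_pi_fintype]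
    simp [mul_comm]
  rw [← hspan, Submodule.finrank_add_finrank_orthogonal, hspace]

/-- An independent edge set with `2 * |W| - 3` edges is infinitesimally rigid: its infinitesimal
motions form a space of dimension three, which is filled by the infinitesimal isometries. -/
lemma Independent.inner_eq_zero (hp : Independent E p) (hE : ∀ e ∈ E, #e = 2)
    (hcard : #E + 3 = 2 * Fintype.card W)
    (hy : ∀ a b, {a, b} ∈ E → inner ℝ (p a - p b) (y a - y b) = 0) (a b : W) :
    inner ℝ (p a - p b) (y a - y b) = 0 := by
  obtain ⟨e, he⟩ : E.Nonempty := card_pos.1 (by omega)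
  obtain ⟨c, d, -, rfl⟩ := card_eq_two.1 (hE e he)
  have hrange_le : LinearMap.range (infinitesimalIsometry p) ≤
      (Submodule.span ℝ (rigidityRow p '' E))ᗮ := by
    rintro _ ⟨r, rfl⟩
    exact mem_orthogonal_span_rigidityRow hE fun a b _ => inner_infinitesimalIsometry p r a b
  have hrange : LinearMap.range (infinitesimalIsometry p) =
      (Submodule.span ℝ (rigidityRow p '' E))ᗮ := by
    refine Submodule.eq_of_le_of_finrank_eq hrange_le ?_
    have := hp.finrank_orthogonal_span
    rw [LinearMap.finrank_range_of_inj (infinitesimalIsometry_injective (hp.ne he))]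
    have : Module.finrank ℝ (Plane × ℝ) = 3 := by simp
    omega
  obtain ⟨r, hr⟩ := hrange.ge (mem_orthogonal_span_rigidityRow hE hy)
  have y_eq : ∀ w, y w = infinitesimalIsometry p r w := fun w => congr($hr.symm w)
  rw [y_eq, y_eq, inner_infinitesimalIsometry]

/-- The averaging trick: the difference of two realisations is an infinitesimal motion of their
midpoint exactly where they agree in length. -/
lemma inner_midpoint_sub_eq_zero_iff {P Q P' Q' : Plane} :
    inner ℝ (midpoint ℝ P P' - midpoint ℝ Q Q') ((P - P') - (Q - Q')) = 0 ↔
      dist P Q = dist P' Q' := by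
  have hmid : midpoint ℝ P P' - midpoint ℝ Q Q' = (2⁻¹ : ℝ) • ((P - Q) + (P' - Q')) := by
    simp only [midpoint_eq_smul_add, invOf_eq_inv]
    module
  rw [hmid, sub_sub_sub_comm, real_inner_smul_left, mul_eq_zero, or_iff_right (by norm_num),
    real_inner_add_sub_eq_zero_iff, dist_eq_norm, dist_eq_norm]

lemma Independent.congruent (hE : ∀ e ∈ E, #e = 2) (hcard : #E + 3 = 2 * Fintype.card W)
    (hm : Independent E fun w => midpoint ℝ (p w) (q w))
    (h : ∀ a b, {a, b} ∈ E → dist (p a) (p b) = dist (q a) (q b)) : Congruent p q :=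
  congruent_iff_dist_eq.2 fun a b => inner_midpoint_sub_eq_zero_iff.1 <|
    hm.inner_eq_zero (y := fun w => p w - q w) hE hcard
      (fun a b hab => inner_midpoint_sub_eq_zero_iff.2 (h a b hab)) a b

end InfinitesimalRigidity

section Motions

open Finset Filter Topology

variable {W : Type*} {G : SimpleGraph W} {E : Finset (Finset W)} {p : W → Plane}
  {φ : ℝ → W → Plane}

lemma IsContinuousMotion.isTrivialMotion (hφ : IsContinuousMotion G p φ)
    (h : ∀ t ∈ Set.Ioo (-1 : ℝ) 1, Congruent p (φ t) →
      ∀ᶠ s in 𝓝[Set.Ioo (-1) 1] t, Congruent p (φ s)) : IsTrivialMotion p φ := by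
  let T : Set (Set.Ioo (-1 : ℝ) 1) := {t | Congruent p (φ t)}
  have hcont : ∀ a, Continuous fun t : Set.Ioo (-1 : ℝ) 1 => φ t a := fun a =>
    (continuous_apply a).comp hφ.continuousOn.domRestrict
  have hclosed : IsClosed T := by
    simp only [T, congruent_iff_dist_eq, Set.ofPred_forall]
    exact isClosed_iInter fun a => isClosed_iInter fun b =>
      isClosed_eq continuous_const ((hcont a).dist (hcont b))
  have hopen : IsOpen T := isOpen_iff_eventually.2 fun t ht => by
    rw [nhds_subtype_eq_comap_nhdsWithin]
    exact (h t t.2 ht).comap _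
  have : PreconnectedSpace (Set.Ioo (-1 : ℝ) 1) := Subtype.preconnectedSpace isPreconnected_Ioo
  have huniv : T = Set.univ := IsClopen.eq_univ ⟨hclosed, hopen⟩
    ⟨⟨0, by norm_num⟩, by simpa [T, hφ.start] using Congruent.refl p⟩
  intro t ht
  have : (⟨t, ht⟩ : Set.Ioo (-1 : ℝ) 1) ∈ T := huniv ▸ Set.mem_univ _
  exact this

/-- Laman's theorem, sufficiency. -/
theorem isRigid_of_isSparse [Fintype W] [DecidableEq W] (hs : IsSparse E) (hE : ∀ e ∈ E, #e = 2)
    (hEG : ∀ a b, {a, b} ∈ E → G.Adj a b) (hcard : #E + 3 = 2 * Fintype.card W) : IsRigid G := by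
  rintro p hp ⟨φ, hφ, hnontrivial⟩
  refine hnontrivial (hφ.isTrivialMotion fun t ht hpt => ?_)
  have hcont : Continuous fun (ψ : W → Plane) w => midpoint ℝ (ψ w) (φ t w) := by
    simp only [midpoint_eq_smul_add]
    fun_prop
  have hnear : ∀ᶠ s in 𝓝[Set.Ioo (-1) 1] t, Independent E fun w => midpoint ℝ (φ s w) (φ t w) :=
    (hφ.continuousOn t ht).eventually_mem <|
      ((isOpen_independent E).preimage hcont).mem_nhds <| by
        simpa using (hs.independent hE hp).congr hpt
  filter_upwards [hnear, self_mem_nhdsWithin] with s hs hsI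
  refine hpt.trans (hs.congruent hE hcard fun a b hab => ?_).symm
  rw [← hφ.equivalent s hsI a b (hEG a b hab), ← hφ.equivalent t ht a b (hEG a b hab)]

end Motions

section RigidSubgraphs

variable {V W X F : Type*} {a b x y a' b' x' y' : Plane}

lemma norm_sq_mul_inner (u x y : Plane) :
    ‖u‖ ^ 2 * inner ℝ x y = inner ℝ u x * inner ℝ u y + cross u x * cross u y := by
  simp only [EuclideanSpace.real_norm_sq_eq, PiLp.inner_apply, Fin.sum_univ_two, cross,
    RCLike.inner_apply, conj_trivial]
  ring

lemma inner_sub_sub_eq_of_dist_eq [NormedAddCommGroup F] [InnerProductSpace ℝ F]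
    {a b x a' b' x' : F} (hab : dist a b = dist a' b') (hax : dist a x = dist a' x')
    (hbx : dist b x = dist b' x') :
    inner ℝ (b - a) (x - a) = inner ℝ (b' - a') (x' - a') := by
  simp only [dist_eq_norm'] at hab hax
  simp only [dist_eq_norm] at hbx
  simp only [real_inner_eq_norm_mul_self_add_norm_mul_self_sub_norm_sub_mul_self_div_two,
    sub_sub_sub_cancel_right, hab, hax, hbx]

/-- A moving triangle of constant side lengths cannot be reflected, since its signed area is
continuous and constant up to sign. -/
lemma cross_sub_eq_of_dist_eq [TopologicalSpace X] {s : Set X} (hs : IsPreconnected s)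
    {a b x : X → Plane} {t₀ t : X} (ha : ContinuousOn a s) (hb : ContinuousOn b s)
    (hx : ContinuousOn x s) (hab : ∀ t ∈ s, dist (a t) (b t) = dist (a t₀) (b t₀))
    (hax : ∀ t ∈ s, dist (a t) (x t) = dist (a t₀) (x t₀))
    (hbx : ∀ t ∈ s, dist (b t) (x t) = dist (b t₀) (x t₀)) (ht₀ : t₀ ∈ s) (ht : t ∈ s) :
    cross (b t - a t) (x t - a t) = cross (b t₀ - a t₀) (x t₀ - a t₀) := by
  have hcont : ContinuousOn (fun t => cross (b t - a t) (x t - a t)) s := by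
    unfold cross
    fun_prop
  have hsq : ∀ t ∈ s,
      cross (b t - a t) (x t - a t) ^ 2 = cross (b t₀ - a t₀) (x t₀ - a t₀) ^ 2 := by
    intro t ht
    have hinner := inner_sub_sub_eq_of_dist_eq (hab t ht) (hax t ht) (hbx t ht)
    have h := norm_sq_mul_inner (b t - a t) (x t - a t) (x t - a t)
    have h₀ := norm_sq_mul_inner (b t₀ - a t₀) (x t₀ - a t₀) (x t₀ - a t₀)
    rw [real_inner_self_eq_norm_sq, ← dist_eq_norm', ← dist_eq_norm'] at h h₀
    rw [hab t ht, hax t ht, h₀, hinner] at h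
    linear_combination -h
  by_cases hzero : cross (b t₀ - a t₀) (x t₀ - a t₀) = 0
  · simpa [hzero] using hsq t ht
  · exact hs.eq_of_sq_eq hcont continuousOn_const hsq (fun _ => hzero) ht₀ rfl ht

lemma dist_eq_of_cross_sub_eq (hne : a ≠ b) (hab : dist a b = dist a' b')
    (hax : dist a x = dist a' x') (hbx : dist b x = dist b' x')
    (hay : dist a y = dist a' y') (hby : dist b y = dist b' y')
    (hx : cross (b - a) (x - a) = cross (b' - a') (x' - a'))
    (hy : cross (b - a) (y - a) = cross (b' - a') (y' - a')) : dist x y = dist x' y' := by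
  have hinner : inner ℝ (x - a) (y - a) = inner ℝ (x' - a') (y' - a') := by
    refine mul_left_cancel₀ (pow_ne_zero 2 (norm_ne_zero_iff.2 (sub_ne_zero.2 hne.symm))) ?_
    rw [norm_sq_mul_inner, inner_sub_sub_eq_of_dist_eq hab hax hbx,
      inner_sub_sub_eq_of_dist_eq hab hay hby, hx, hy, ← norm_sq_mul_inner, ← dist_eq_norm',
      ← dist_eq_norm', hab]
  rw [dist_eq_norm'] at hax hay
  rw [dist_eq_norm, dist_eq_norm, ← sub_sub_sub_cancel_right x y a,
    ← sub_sub_sub_cancel_right x' y' a', ← sq_eq_sq₀ (norm_nonneg _) (norm_nonneg _),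
    norm_sub_sq_real (x - a), norm_sub_sq_real (x' - a'), hinner, hax, hay, dist_eq_norm',
    dist_eq_norm']

lemma isTrivialMotion_of_dist_eq {p : W → Plane} {φ : ℝ → W → Plane} {u v : W}
    (hcont : ContinuousOn φ (Set.Ioo (-1) 1)) (h0 : φ 0 = p) (huv : p u ≠ p v)
    (hu : ∀ t ∈ Set.Ioo (-1 : ℝ) 1, ∀ w, dist (φ t u) (φ t w) = dist (p u) (p w))
    (hv : ∀ t ∈ Set.Ioo (-1 : ℝ) 1, ∀ w, dist (φ t v) (φ t w) = dist (p v) (p w)) :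
    IsTrivialMotion p φ := by
  intro t ht
  have hcross : ∀ w, cross (φ t v - φ t u) (φ t w - φ t u) = cross (p v - p u) (p w - p u) := by
    subst h0
    have hc := continuousOn_pi.1 hcont
    exact fun w => cross_sub_eq_of_dist_eq isPreconnected_Ioo (hc u) (hc v) (hc w)
      (fun t ht => hu t ht v) (fun t ht => hu t ht w) (fun t ht => hv t ht w) (by norm_num) ht
  exact congruent_iff_dist_eq.2 fun x y => dist_eq_of_cross_sub_eq huv (hu t ht v).symm
    (hu t ht x).symm (hv t ht x).symm (hu t ht y).symm (hv t ht y).symm (hcross x).symm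
    (hcross y).symm

lemma IsGeneric.comp {p : V → Plane} (hp : IsGeneric p) {f : W → V}
    (hf : Function.Injective f) : IsGeneric (p ∘ f) :=
  AlgebraicIndependent.comp hp (Prod.map f id) (hf.prodMap Function.injective_id)

lemma IsRigid.isTrivialMotion_comp {H : SimpleGraph W} {K : SimpleGraph V} (hH : IsRigid H)
    {f : H →g K} (hf : Function.Injective f) {p : V → Plane} (hp : IsGeneric p)
    {φ : ℝ → V → Plane} (hφ : IsContinuousMotion K p φ) :
    IsTrivialMotion (p ∘ f) fun t => φ t ∘ f := by
  by_contra hnontrivial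
  refine hH _ (hp.comp hf) ⟨_, ⟨?_, ?_, ?_⟩, hnontrivial⟩
  · exact continuousOn_pi.2 fun w => continuousOn_pi.1 hφ.continuousOn (f w)
  · simp [hφ.start]
  · exact fun t ht _ _ hadj => hφ.equivalent t ht _ _ (f.map_adj hadj)

lemma IsRigid.of_bijective_hom {H : SimpleGraph W} {K : SimpleGraph V} (hH : IsRigid H)
    {f : H →g K} (hf : Function.Bijective f) : IsRigid K := by
  rintro p hp ⟨φ, hφ, hnontrivial⟩
  refine hnontrivial fun t ht u v => ?_
  obtain ⟨a, rfl⟩ := hf.2 u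
  obtain ⟨b, rfl⟩ := hf.2 v
  exact hH.isTrivialMotion_comp hf.1 hp hφ t ht a b

theorem IsRigid.sup {G : SimpleGraph V} {H K : G.Subgraph} (hH : IsRigid H.coe)
    (hK : IsRigid K.coe) {u v : V} (huv : u ≠ v) (huH : u ∈ H.verts) (hvH : v ∈ H.verts)
    (huK : u ∈ K.verts) (hvK : v ∈ K.verts) : IsRigid (H ⊔ K).coe := by
  rintro p hp ⟨φ, hφ, hnontrivial⟩
  have dist_eq : ∀ {J : G.Subgraph}, IsRigid J.coe → J ≤ H ⊔ K → ∀ t ∈ Set.Ioo (-1 : ℝ) 1,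
      ∀ x y : (H ⊔ K).verts, x.1 ∈ J.verts → y.1 ∈ J.verts →
        dist (φ t x) (φ t y) = dist (p x) (p y) := fun hJ hle t ht x y hx hy =>
    (congruent_iff_dist_eq.1 (hJ.isTrivialMotion_comp
      (SimpleGraph.Subgraph.inclusion.injective hle) hp hφ t ht) ⟨x, hx⟩ ⟨y, hy⟩).symm
  have dist_eq_of_common : ∀ w : (H ⊔ K).verts, w.1 ∈ H.verts → w.1 ∈ K.verts →
      ∀ t ∈ Set.Ioo (-1 : ℝ) 1, ∀ x, dist (φ t w) (φ t x) = dist (p w) (p x) := by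
    intro w hwH hwK t ht x
    obtain hx | hx := x.2
    · exact dist_eq hH le_sup_left t ht w x hwH hx
    · exact dist_eq hK le_sup_right t ht w x hwK hx
  exact hnontrivial <| isTrivialMotion_of_dist_eq (u := ⟨u, .inl huH⟩) (v := ⟨v, .inl hvH⟩)
    hφ.continuousOn hφ.start (hp.injective.ne (Subtype.coe_ne_coe.1 huv))
    (dist_eq_of_common _ huH huK) (dist_eq_of_common _ hvH hvK)

lemma not_isRigid_bot {p : W → Plane} (hp : IsGeneric p) {u v : W} (huv : u ≠ v) :
    ¬ IsRigid (⊥ : SimpleGraph W) := by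
  classical
  refine fun hrigid => hrigid p hp
    ⟨fun t => Function.update p u (p u + t • (p u - p v)), ⟨?_, ?_, ?_⟩, fun htrivial => ?_⟩
  · exact (continuous_const.update u (by fun_prop)).continuousOn
  · simp
  · exact fun _ _ _ _ hadj => hadj.elim
  · have hdist : dist (p u) (p v) = dist (p u + (1 / 2 : ℝ) • (p u - p v)) (p v) := by
      simpa [huv.symm] using congruent_iff_dist_eq.1 (htrivial (1 / 2) (by norm_num)) u v
    have hstretch : p u + (1 / 2 : ℝ) • (p u - p v) - p v = (3 / 2 : ℝ) • (p u - p v) := by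
      module
    rw [dist_eq_norm, dist_eq_norm, hstretch, norm_smul, Real.norm_of_nonneg (by norm_num)] at hdist
    exact hp.injective.ne huv (sub_eq_zero.1 (norm_eq_zero.1 (by linarith)))

end RigidSubgraphs

section Bodies

open Finset

variable {V W : Type*} {G : SimpleGraph V} {E 𝓑 : Finset (Finset V)} {X : Finset V} {a b : V}

/-- The members of a system that lie in the image of an embedding, transported to its domain. -/
noncomputable def pullback (f : W ↪ V) (E : Finset (Finset V)) : Finset (Finset W) :=
  E.preimage (Finset.map f) (map_injective f).injOn

lemma mem_pullback {f : W ↪ V} {e : Finset W} : e ∈ pullback f E ↔ e.map f ∈ E :=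
  mem_preimage

variable [DecidableEq V]

/-- A set of edges of `G`, each encoded as the pair of its ends. -/
def IsEdgeSystem (G : SimpleGraph V) (E : Finset (Finset V)) : Prop :=
  ∀ e ∈ E, ∃ a b, G.Adj a b ∧ e = {a, b}

lemma IsEdgeSystem.card_eq_two (hE : IsEdgeSystem G E) : ∀ e ∈ E, #e = 2 := by
  intro e he
  obtain ⟨a, b, hab, rfl⟩ := hE e he
  exact card_pair hab.ne

lemma IsEdgeSystem.adj (hE : IsEdgeSystem G E) (h : {a, b} ∈ E) : G.Adj a b := by
  obtain ⟨c, d, hcd, heq⟩ := hE _ h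
  have hsym : s(a, b) = s(c, d) := by
    rw [Sym2.eq_iff, ← Set.pair_eq_pair_iff, ← coe_pair, heq, coe_pair]
  rwa [← SimpleGraph.mem_edgeSet, hsym, SimpleGraph.mem_edgeSet]

lemma IsSparse.pullback [DecidableEq W] (hs : IsSparse E) (f : W ↪ V) :
    IsSparse (pullback f E) := by
  intro Y hY
  have hspread : spread (FlexGraph.pullback f E) Y =
      spread ((FlexGraph.pullback f E).map (mapEmbedding f).toEmbedding) (Y.map f) := by
    rw [spread, spread, sum_map]
    exact sum_congr rfl fun e _ => by simp [← map_inter]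
  have hsub : (FlexGraph.pullback f E).map (mapEmbedding f).toEmbedding ⊆ E := by
    intro e he
    obtain ⟨e', he', rfl⟩ := mem_map.1 he
    exact mem_pullback.1 he'
  have hbound := hs (Y.map f) (by rwa [card_map])
  rw [card_map] at hbound
  exact (Nat.add_le_add_right (hspread.trans_le (spread_mono_left hsub _)) 3).trans hbound

lemma card_pullback [Fintype W] (f : W ↪ V) (hE : ∀ e ∈ E, #e = 2) :
    #(pullback f E) = spread E (univ.map f) := by
  rw [spread_eq_card_filter hE, ← card_map (mapEmbedding f).toEmbedding]
  congr 1
  ext e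
  simp only [mem_map, mem_pullback, mem_filter, RelEmbedding.coe_toEmbedding, mapEmbedding_apply]
  constructor
  · rintro ⟨e', he', rfl⟩
    exact ⟨he', map_subset_map.2 (subset_univ _)⟩
  · rintro ⟨he, hsub⟩
    obtain ⟨u, -, rfl⟩ := subset_map_iff.1 hsub
    exact ⟨u, he, rfl⟩

lemma IsTight.isRigid_induce (hX : IsTight E X) (hs : IsSparse E) (hE : IsEdgeSystem G E) :
    IsRigid ((⊤ : G.Subgraph).induce (X : Set V)).coe := by
  let f : X ↪ V := Function.Embedding.subtype _
  have map_univ : univ.map f = X := by simp [f, attach_map_val]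
  refine isRigid_of_isSparse (W := X) (hs.pullback f) (fun e he => ?_) (fun a b hab => ?_) ?_
  · rw [← card_map f, hE.card_eq_two _ (mem_pullback.1 he)]
  · exact ⟨a.2, b.2, hE.adj (by simpa [f] using mem_pullback.1 hab)⟩
  · rw [card_pullback f hE.card_eq_two, map_univ, Fintype.card_coe, hX.2]

/-- A saturated system of vertex sets which induce rigid subgraphs and cover the edges. -/
structure IsBodySystem (G : SimpleGraph V) (𝓑 : Finset (Finset V)) : Prop
    extends IsSaturated 𝓑 where
  exists_mem : ∀ a b, G.Adj a b → ∃ B ∈ 𝓑, a ∈ B ∧ b ∈ B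
  exists_adj : ∀ B ∈ 𝓑, ∃ a ∈ B, ∃ b ∈ B, G.Adj a b
  isRigid : ∀ B ∈ 𝓑, IsRigid ((⊤ : G.Subgraph).induce (B : Set V)).coe

theorem exists_isBodySystem [Finite V] (G : SimpleGraph V) : ∃ 𝓑, IsBodySystem G 𝓑 := by
  have hempty : IsSparse (∅ : Finset (Finset V)) ∧ IsEdgeSystem G ∅ :=
    ⟨fun X hX => by rw [spread, sum_empty]; omega, by simp [IsEdgeSystem]⟩
  obtain ⟨E, -, ⟨hs, hE⟩, hmax⟩ :=
    (Set.toFinite {E | IsSparse E ∧ IsEdgeSystem G E}).exists_le_maximal hempty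
  refine ⟨components E, hs.isSaturated_components, fun a b hab => ?_, fun B hB => ?_,
    fun B hB => (mem_components.1 hB).1.isRigid_induce hs hE⟩
  · obtain ⟨hnotMem, hsparse⟩ | ⟨T, hT, haT, hbT⟩ := hs.insert_pair_or hab.ne
    · have hedges : IsEdgeSystem G (insert {a, b} E) :=
        (forall_mem_insert ..).2 ⟨⟨a, b, hab, rfl⟩, hE⟩
      exact absurd (hmax ⟨hsparse, hedges⟩ (subset_insert _ _) (mem_insert_self _ _)) hnotMem
    · obtain ⟨R, hR, hTR⟩ := hT.exists_mem_components
      exact ⟨R, hR, hTR haT, hTR hbT⟩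
  · have hB := (mem_components.1 hB).1.2
    rw [spread_eq_card_filter hE.card_eq_two] at hB
    obtain ⟨e, he⟩ := card_pos.1 (by omega : 0 < #(E.filter (· ⊆ B)))
    obtain ⟨he, heB⟩ := mem_filter.1 he
    obtain ⟨a, b, hab, rfl⟩ := hE e he
    exact ⟨a, heB (by simp), b, heB (by simp), hab⟩

lemma IsBodySystem.exists_notMem (h𝓑 : IsBodySystem G 𝓑) (hG : IsFlexible G) {B : Finset V}
    (hB : B ∈ 𝓑) : ∃ v, v ∉ B := by
  by_contra! hmem
  exact hG ((h𝓑.isRigid B hB).of_bijective_hom (f := SimpleGraph.Subgraph.hom _)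
    ⟨Subtype.val_injective, fun v => ⟨⟨v, hmem v⟩, rfl⟩⟩)

end Bodies

section RigidComponents

open Finset

variable {V : Type*} [DecidableEq V] {G : SimpleGraph V} {𝓑 : Finset (Finset V)} {p : V → Plane}
  {R : G.Subgraph}

lemma IsFlexible.exists_isGeneric {V : Type*} {G : SimpleGraph V} (hG : IsFlexible G) :
    ∃ p : V → Plane, IsGeneric p := by
  by_contra! hnone
  exact hG fun p hp => (hnone p hp).elim

lemma exists_adj_of_isRigid_coe {V : Type*} {G : SimpleGraph V} {p : V → Plane}
    (hp : IsGeneric p) {R : G.Subgraph} (hR : IsRigid R.coe) (h : R.verts.Nontrivial) :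
    ∃ a b, R.Adj a b := by
  by_contra! hadj
  obtain ⟨x, hx, y, hy, hxy⟩ := h
  have hbot : R.coe = ⊥ := by
    ext a b
    simpa using hadj a b
  exact not_isRigid_bot (hp.comp Subtype.val_injective) (u := ⟨x, hx⟩) (v := ⟨y, hy⟩)
    (by simpa using hxy) (hbot ▸ hR)

lemma IsBodySystem.exists_induce_le [Nonempty V] (h𝓑 : IsBodySystem G 𝓑) (hp : IsGeneric p)
    (hG : ∀ v, ∃ w, G.Adj v w) (hR : IsRigidComponent G R) :
    ∃ B ∈ 𝓑, (⊤ : G.Subgraph).induce (B : Set V) ≤ R := by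
  obtain hR1 | hR2 := R.verts.subsingleton_or_nontrivial
  · obtain ⟨v, hv⟩ : ∃ v, R.verts ⊆ {v} := by
      obtain h | ⟨v, h⟩ := hR1.eq_empty_or_singleton
      exacts [⟨Classical.arbitrary V, by simp [h]⟩, ⟨v, h.le⟩]
    obtain ⟨w, hvw⟩ := hG v
    obtain ⟨B, hB, hvB, -⟩ := h𝓑.exists_mem v w hvw
    refine ⟨B, hB, hR.2 (h𝓑.isRigid B hB) ⟨fun x hx => ?_, fun x y hxy => ?_⟩⟩
    · rwa [hv hx]
    · exact absurd (hR1 hxy.fst_mem hxy.snd_mem) hxy.ne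
  · obtain ⟨a, b, hab⟩ := exists_adj_of_isRigid_coe hp hR.1 hR2
    obtain ⟨B, hB, ha, hb⟩ := h𝓑.exists_mem a b hab.adj_sub
    have hsup := hR.1.sup (h𝓑.isRigid B hB) hab.ne hab.fst_mem hab.snd_mem ha hb
    exact ⟨B, hB, le_sup_right.trans (hR.2 hsup le_sup_left)⟩

theorem IsBodySystem.numRigidComponents_le [Nonempty V] (h𝓑 : IsBodySystem G 𝓑)
    (hp : IsGeneric p) (hG : ∀ v, ∃ w, G.Adj v w) : numRigidComponents G ≤ #𝓑 := by
  choose! f hf𝓑 hf using fun R (hR : IsRigidComponent G R) => h𝓑.exists_induce_le hp hG hR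
  rw [numRigidComponents, ← Set.ncard_coe_finset]
  refine Set.ncard_le_ncard_of_injOn f hf𝓑 (fun R hR T hT hRT => ?_) 𝓑.finite_toSet
  obtain ⟨a, ha, b, hb, hab⟩ := h𝓑.exists_adj _ (hf𝓑 R hR)
  have hfT : (⊤ : G.Subgraph).induce (f R : Set V) ≤ T := hRT ▸ hf T hT
  have hsup := hR.1.sup hT.1 hab.ne ((hf R hR).1 ha) ((hf R hR).1 hb) (hfT.1 ha) (hfT.1 hb)
  exact le_antisymm (le_sup_left.trans (hT.2 hsup le_sup_right))
    (le_sup_right.trans (hR.2 hsup le_sup_left))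

end RigidComponents

section StableSeparations

variable {V : Type*} {G : SimpleGraph V} {G₁ G₂ K₁ K₂ : G.Subgraph} {A S : Set V} {a b : V}

lemma IsStableSeparation.symm (h : IsStableSeparation G G₁ G₂) : IsStableSeparation G G₂ G₁ := by
  obtain ⟨⟨⟨E₁, E₂, hunion, hdisjoint, h₁, h₂⟩, hl, hr⟩, hS⟩ := h
  exact ⟨⟨⟨E₂, E₁, by rwa [Set.union_comm], hdisjoint.symm, h₂, h₁⟩, hr, hl⟩, by rwa [inf_comm]⟩

lemma IsStableSeparation.adj_right_iff (h : IsStableSeparation G G₁ G₂) (hab : G.Adj a b) :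
    G₂.Adj a b ↔ ¬ G₁.Adj a b := by
  obtain ⟨⟨⟨E₁, E₂, hunion, hdisjoint, rfl, rfl⟩, -, -⟩, -⟩ := h
  have hmem : s(a, b) ∈ E₁ ∪ E₂ := hunion ▸ (SimpleGraph.mem_edgeSet G).2 hab
  simp only [edgeInduced, hab, true_and]
  exact ⟨fun h₂ h₁ => Set.disjoint_left.1 hdisjoint h₁ h₂, hmem.resolve_left⟩

/-- The subgraph of the edges with an end in `A`. -/
def meetingSubgraph (G : SimpleGraph V) (A : Set V) : G.Subgraph :=
  edgeInduced G {e | ∃ x ∈ e, x ∈ A}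

/-- The subgraph of the edges with no end in `A`. -/
def avoidingSubgraph (G : SimpleGraph V) (A : Set V) : G.Subgraph :=
  edgeInduced G {e | ¬ ∃ x ∈ e, x ∈ A}

lemma edgeInduced_inter_edgeSet (G : SimpleGraph V) (E : Set (Sym2 V)) :
    edgeInduced G (E ∩ G.edgeSet) = edgeInduced G E := by
  ext a b
  · exact exists_congr fun b => by simp +contextual
  · simp +contextual [edgeInduced]

lemma meetingSubgraph_adj : (meetingSubgraph G A).Adj a b ↔ G.Adj a b ∧ (a ∈ A ∨ b ∈ A) := by
  simp [meetingSubgraph, edgeInduced]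

lemma avoidingSubgraph_adj : (avoidingSubgraph G A).Adj a b ↔ G.Adj a b ∧ a ∉ A ∧ b ∉ A := by
  simp [avoidingSubgraph, edgeInduced]

lemma mem_edgeInduced_verts {E : Set (Sym2 V)} :
    a ∈ (edgeInduced G E).verts ↔ ∃ b, (edgeInduced G E).Adj a b :=
  Iff.rfl

lemma isStableSeparation_meeting_avoiding (hS : G.IsIndepSet S)
    (hnbr : ∀ a ∈ A, ∀ b, G.Adj a b → b ∈ A ∪ S) (hA : ∃ a ∈ A, ∃ b, G.Adj a b)
    (hAS : ∃ a ∉ A ∪ S, ∃ b, G.Adj a b) :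
    IsStableSeparation G (meetingSubgraph G A) (avoidingSubgraph G A) := by
  have mem_meeting : ∀ a ∈ (meetingSubgraph G A).verts, a ∈ A ∪ S := by
    intro a ha
    obtain ⟨b, hb⟩ := mem_edgeInduced_verts.1 ha
    obtain ⟨hab, h | h⟩ := meetingSubgraph_adj.1 hb
    exacts [.inl h, hnbr b h a hab.symm]
  have mem_avoiding : ∀ a ∈ (avoidingSubgraph G A).verts, a ∉ A := by
    intro a ha
    obtain ⟨b, hb⟩ := mem_edgeInduced_verts.1 ha
    exact (avoidingSubgraph_adj.1 hb).2.1
  refine ⟨⟨⟨{e | ∃ x ∈ e, x ∈ A} ∩ G.edgeSet, {e | ¬ ∃ x ∈ e, x ∈ A} ∩ G.edgeSet, ?_, ?_,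
    (edgeInduced_inter_edgeSet ..).symm, (edgeInduced_inter_edgeSet ..).symm⟩, ?_, ?_⟩, ?_⟩
  · rw [← Set.union_inter_distrib_right, ← Set.compl_ofPred, Set.union_compl_self, Set.univ_inter]
  · exact Set.disjoint_left.2 fun e h₁ h₂ => h₂.1 h₁.1
  · obtain ⟨a, ha, b, hab⟩ := hA
    exact ⟨a, ⟨b, meetingSubgraph_adj.2 ⟨hab, .inl ha⟩⟩, fun h => mem_avoiding a h ha⟩
  · obtain ⟨a, ha, b, hab⟩ := hAS
    exact ⟨a, ⟨b, avoidingSubgraph_adj.2 ⟨hab, fun h => ha (.inl h),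
      fun h => ha (hnbr b h a hab.symm)⟩⟩, fun h => ha (mem_meeting a h)⟩
  · exact hS.mono fun a ha => (mem_meeting a ha.1).resolve_left (mem_avoiding a ha.2)

open Finset

variable {𝓑 : Finset (Finset V)} {B D : Finset V}

/-- The subgraph `H` contains all edges of `G` within `B`. -/
def ContainsEdges (H : G.Subgraph) (B : Finset V) : Prop :=
  ∀ a ∈ B, ∀ b ∈ B, G.Adj a b → H.Adj a b

lemma IsStableSeparation.not_containsEdges_left (h : IsStableSeparation G G₁ G₂)
    (h₂ : ContainsEdges G₂ B) (hB : ∃ a ∈ B, ∃ b ∈ B, G.Adj a b) : ¬ ContainsEdges G₁ B := by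
  obtain ⟨a, ha, b, hb, hab⟩ := hB
  exact fun h₁ => (h.adj_right_iff hab).1 (h₂ a ha b hb hab) (h₁ a ha b hb hab)

variable [DecidableEq V]

lemma IsSaturated.eq_of_subset (h𝓑 : IsSaturated 𝓑) (hB : B ∈ 𝓑) (hD : D ∈ 𝓑) (h : B ⊆ D) :
    B = D := by
  obtain ⟨x, hx, y, hy, hxy⟩ := one_lt_card.1 (h𝓑.two_le_card B hB)
  exact h𝓑.eq_of_mem hB hD hxy hx hy (h hx) (h hy)

lemma IsSaturated.not_isJoined (h𝓑 : IsSaturated 𝓑) (hD : D ∈ 𝓑) (ha : a ∉ D) :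
    ¬ IsJoined 𝓑 a D := by
  rintro ⟨T, hT, haT, hDT⟩
  obtain ⟨R, hR, hTR⟩ := h𝓑.exists_superset T hT
  exact ha (h𝓑.eq_of_subset hD hR (hDT.trans hTR) ▸ hTR haT)

lemma IsBodySystem.isIndepSet_of_isStableSide (h𝓑 : IsBodySystem G 𝓑) {A S : Finset V}
    (h : IsStableSide 𝓑 A S) : G.IsIndepSet S := by
  intro a ha b hb hne hab
  obtain ⟨C, hC, haC, hbC⟩ := h𝓑.exists_mem a b hab
  exact hne (card_le_one.1 (h.card_inter_le_one C hC) a (mem_inter.2 ⟨haC, ha⟩) b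
    (mem_inter.2 ⟨hbC, hb⟩))

theorem IsBodySystem.exists_isStableSeparation [Finite V] (h𝓑 : IsBodySystem G 𝓑) (hB : B ∈ 𝓑)
    (hD : D ∈ 𝓑) (hBD : B ≠ D) :
    ∃ G₁ G₂, IsStableSeparation G G₁ G₂ ∧ ContainsEdges G₁ B ∧ ContainsEdges G₂ D := by
  obtain ⟨u, huB, huD⟩ := not_subset.1 fun hsub => hBD (h𝓑.eq_of_subset hB hD hsub)
  obtain ⟨A, S, hAS, huA, hDA⟩ := h𝓑.sparse.exists_isStableSide
    (h𝓑.sparse.isTight_of_subset_mem hD (h𝓑.two_le_card D hD) subset_rfl)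
    (h𝓑.not_isJoined hD huD)
  have hS := h𝓑.isIndepSet_of_isStableSide hAS
  have hnbr : ∀ a ∈ (A : Set V), ∀ b, G.Adj a b → b ∈ (A ∪ S : Set V) := by
    intro a ha b hab
    obtain ⟨C, hC, haC, hbC⟩ := h𝓑.exists_mem a b hab
    exact_mod_cast hAS.subset_union C hC a haC ha hbC
  have meets : ∀ a ∈ B, ∀ b ∈ B, G.Adj a b → a ∈ A ∨ b ∈ A := by
    intro a ha b hb hab
    by_contra! hnotMem
    have hsub := hAS.subset_union B hB u huB huA
    exact hS ((mem_union.1 (hsub ha)).resolve_left hnotMem.1)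
      ((mem_union.1 (hsub hb)).resolve_left hnotMem.2) hab.ne hab
  have avoids : ∀ a ∈ D, a ∉ A := fun a ha => disjoint_left.1 hDA ha
  refine ⟨_, _, isStableSeparation_meeting_avoiding hS hnbr ?_ ?_,
    fun a ha b hb hab => meetingSubgraph_adj.2 ⟨hab, meets a ha b hb hab⟩,
    fun a ha b hb hab => avoidingSubgraph_adj.2 ⟨hab, avoids a ha, avoids b hb⟩⟩
  · obtain ⟨a, ha, b, hb, hab⟩ := h𝓑.exists_adj B hB
    exact (meets a ha b hb hab).elim (fun h => ⟨a, h, b, hab⟩) fun h => ⟨b, h, a, hab.symm⟩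
  · obtain ⟨a, ha, b, hb, hab⟩ := h𝓑.exists_adj D hD
    by_cases haS : a ∈ S
    · exact ⟨b, not_or.2 ⟨avoids b hb, fun hbS => hS haS hbS hab.ne hab⟩, a, hab.symm⟩
    · exact ⟨a, not_or.2 ⟨avoids a ha, haS⟩, b, hab⟩

/-- A body is determined by the set of the stable separations whose first side contains it. -/
theorem IsBodySystem.card_le_two_pow [Finite V] (h𝓑 : IsBodySystem G 𝓑) :
    #𝓑 ≤ 2 ^ numStableSeparations G := by
  classical
  have hfinite := Set.toFinite {P : Sym2 G.Subgraph | ∃ G₁ G₂, P = s(G₁, G₂) ∧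
    IsStableSeparation G G₁ G₂}
  rw [numStableSeparations, Set.ncard_eq_toFinset_card _ hfinite, ← card_powerset]
  refine card_le_card_of_injOn
    (fun B => hfinite.toFinset.filter fun P => ContainsEdges P.out.1 B)
    (fun B _ => mem_powerset.2 (filter_subset _ _)) fun B hB D hD heq => ?_
  by_contra hBD
  obtain ⟨G₁, G₂, hsep, hB₁, hD₂⟩ := h𝓑.exists_isStableSeparation hB hD hBD
  have hiff : ContainsEdges s(G₁, G₂).out.1 B ↔ ContainsEdges s(G₁, G₂).out.1 D := by
    have := Finset.ext_iff.1 heq s(G₁, G₂)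
    rwa [mem_filter, mem_filter, and_congr_right_iff, imp_iff_right] at this
    exact hfinite.mem_toFinset.2 ⟨G₁, G₂, rfl, hsep⟩
  obtain h | h := Sym2.mem_iff.1 (Sym2.out_fst_mem s(G₁, G₂))
  · rw [h] at hiff
    exact hsep.not_containsEdges_left hD₂ (h𝓑.exists_adj D hD) (hiff.1 hB₁)
  · rw [h] at hiff
    exact hsep.symm.not_containsEdges_left hB₁ (h𝓑.exists_adj B hB) (hiff.2 hD₂)

end StableSeparations

section NACColourings

variable {V : Type*} {G : SimpleGraph V} {G₁ G₂ K₁ K₂ K : G.Subgraph} {x y : V}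

lemma Colour.eq_red_of_ne {a : Colour} (h : a ≠ .blue) : a = .red := by
  cases a
  exacts [rfl, absurd rfl h]

lemma Colour.eq_blue_of_ne {a : Colour} (h : a ≠ .red) : a = .blue := by
  cases a
  exacts [absurd rfl h, rfl]

instance : Finite Colour :=
  Finite.of_injective (fun a => a = .red) fun a b h => by
    cases a <;> cases b <;> simp_all

/-- The spanning subgraph formed by the edges of colour `a`. -/
def colourGraph (c : G.edgeSet → Colour) (a : Colour) : SimpleGraph V :=
  SimpleGraph.fromEdgeSet ((↑) '' (c ⁻¹' {a}))

lemma colourGraph_adj {c : G.edgeSet → Colour} {a : Colour} :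
    (colourGraph c a).Adj x y ↔ ∃ h : G.Adj x y, c ⟨s(x, y), h⟩ = a := by
  simp only [colourGraph, SimpleGraph.fromEdgeSet_adj, Set.mem_image, Set.mem_preimage,
    Set.mem_singleton_iff, Subtype.exists, SimpleGraph.mem_edgeSet, exists_and_right,
    exists_eq_right, and_iff_left_iff_imp]
  exact fun h => h.1.ne

/-- If a cycle has a single edge of colour `a`, the rest of the cycle joins the ends of that edge in
colour `b`. -/
lemma monochromatic_or_two_le_ncard {c : G.edgeSet → Colour} {a b : Colour}
    (hba : ∀ d, d ≠ a → d = b)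
    (h : ∀ x y (hxy : G.Adj x y), c ⟨s(x, y), hxy⟩ = a → ¬ (colourGraph c b).Reachable x y)
    {v : V} {w : G.Walk v v} (hw : w.IsCycle) :
    (∃ d, ∀ e : G.edgeSet, (e : Sym2 V) ∈ w.edges → c e = d) ∨
      2 ≤ (colouredEdges c w a).ncard := by
  by_contra! hcon
  obtain ⟨hmono, hlt⟩ := hcon
  have hfinite : (colouredEdges c w a).Finite :=
    (w.edges.finite_toSet.preimage Subtype.val_injective.injOn).subset fun e he => he.1
  have unique := (Set.ncard_le_one hfinite).1 (Nat.lt_succ_iff.1 hlt)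
  obtain ⟨⟨⟨x, y⟩, hxy⟩, he, hne⟩ := hmono b
  have hea : c ⟨s(x, y), hxy⟩ = a := not_imp_comm.1 (hba _) hne
  let H : SimpleGraph V := SimpleGraph.fromEdgeSet {e | e ∈ w.edges}
  have edges_mem : ∀ e ∈ w.edges, e ∈ H.edgeSet := fun e he =>
    (SimpleGraph.edgeSet_fromEdgeSet _).symm ▸
      ⟨he, G.not_isDiag_of_mem_edgeSet (w.edges_subset_edgeSet he)⟩
  have hreach := (SimpleGraph.adj_and_reachable_delete_edges_iff_exists_cycle (G := H)
    (v := x) (w := y)).2 ⟨v, w.transfer H edges_mem, hw.transfer edges_mem,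
      (w.edges_transfer _).symm ▸ he⟩
  refine h x y hxy hea (hreach.2.mono fun p q hpq => ?_)
  obtain ⟨⟨hmem, -⟩, hnot⟩ := (SimpleGraph.deleteEdges_adj ..).1 hpq
  have hadj : G.Adj p q := w.edges_subset_edgeSet hmem
  refine colourGraph_adj.2 ⟨hadj, hba _ fun hpa => hnot ?_⟩
  exact congrArg Subtype.val (unique ⟨s(p, q), hadj⟩ ⟨hmem, hpa⟩ ⟨s(x, y), hxy⟩ ⟨he, hea⟩)

lemma isNACColouring_of_not_reachable {c : G.edgeSet → Colour} (hc : Function.Surjective c)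
    (hred : ∀ x y (hxy : G.Adj x y), c ⟨s(x, y), hxy⟩ = .red →
      ¬ (colourGraph c .blue).Reachable x y)
    (hblue : ∀ x y (hxy : G.Adj x y), c ⟨s(x, y), hxy⟩ = .blue →
      ¬ (colourGraph c .red).Reachable x y) : IsNACColouring G c := by
  refine ⟨hc, fun v w hw => ?_⟩
  obtain hmono | hred2 := monochromatic_or_two_le_ncard (fun _ => Colour.eq_blue_of_ne) hred hw
  · exact .inl hmono
  · exact (monochromatic_or_two_le_ncard (fun _ => Colour.eq_red_of_ne) hblue hw).imp_right
      (And.intro hred2)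

open Classical in
/-- The colouring whose red edges are those of the subgraph `K`. -/
noncomputable def subgraphColouring (K : G.Subgraph) (e : G.edgeSet) : Colour :=
  if (e : Sym2 V) ∈ K.edgeSet then .red else .blue

lemma subgraphColouring_eq_red (hxy : G.Adj x y) :
    subgraphColouring K ⟨s(x, y), hxy⟩ = .red ↔ K.Adj x y := by
  simp [subgraphColouring]

lemma IsStableSeparation.subgraphColouring_eq_blue (h : IsStableSeparation G G₁ G₂)
    (hxy : G.Adj x y) : subgraphColouring G₁ ⟨s(x, y), hxy⟩ = .blue ↔ G₂.Adj x y := by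
  simp [subgraphColouring, h.adj_right_iff hxy]

lemma IsStableSeparation.mem_left_iff (h : IsStableSeparation G G₁ G₂) :
    x ∈ G₁.verts ↔ ∃ y, G₁.Adj x y := by
  obtain ⟨⟨⟨E₁, E₂, -, -, rfl, rfl⟩, -, -⟩, -⟩ := h
  rfl

lemma IsStableSeparation.ne (h : IsStableSeparation G G₁ G₂) : G₁ ≠ G₂ := by
  rintro rfl
  obtain ⟨x, hx⟩ := h.1.2.1
  exact hx.2 hx.1

lemma IsStableSeparation.left_eq_of_adj_iff (hG : IsStableSeparation G G₁ G₂)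
    (hK : IsStableSeparation G K₁ K₂)
    (hadj : ∀ x y, G.Adj x y → (G₁.Adj x y ↔ K₁.Adj x y)) : G₁ = K₁ := by
  have hiff : ∀ x y, G₁.Adj x y ↔ K₁.Adj x y := fun x y =>
    ⟨fun h => (hadj x y h.adj_sub).1 h, fun h => (hadj x y h.adj_sub).2 h⟩
  ext x y
  · simp only [hG.mem_left_iff, hK.mem_left_iff, hiff]
  · exact hiff x y

lemma IsStableSeparation.eq_of_subgraphColouring_eq (hG : IsStableSeparation G G₁ G₂)
    (hK : IsStableSeparation G K₁ K₂) (heq : subgraphColouring G₁ = subgraphColouring K₁) :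
    G₁ = K₁ ∧ G₂ = K₂ := by
  refine ⟨hG.left_eq_of_adj_iff hK fun x y hxy => ?_,
    hG.symm.left_eq_of_adj_iff hK.symm fun x y hxy => ?_⟩
  · rw [← subgraphColouring_eq_red hxy, heq, subgraphColouring_eq_red hxy]
  · rw [← hG.subgraphColouring_eq_blue hxy, heq, hK.subgraphColouring_eq_blue hxy]

lemma mem_of_reachable {H : SimpleGraph V} {U : Set V} (hH : ∀ a b, H.Adj a b → a ∈ U)
    (h : H.Reachable x y) (hxy : x ≠ y) : x ∈ U := by
  obtain ⟨_ | ⟨hadj, _⟩⟩ := h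
  exacts [absurd rfl hxy, hH _ _ hadj]

lemma IsStableSeparation.not_reachable (h : IsStableSeparation G G₁ G₂) {H : SimpleGraph V}
    (hH : ∀ a b, H.Adj a b → G₂.Adj a b) (hxy : G₁.Adj x y) : ¬ H.Reachable x y := by
  intro hreach
  have mem_right : ∀ a b, H.Adj a b → a ∈ G₂.verts := fun a b hab => (hH a b hab).fst_mem
  have hx := mem_of_reachable mem_right hreach hxy.ne
  have hy := mem_of_reachable mem_right hreach.symm hxy.ne.symm
  exact h.2 ⟨hxy.fst_mem, hx⟩ ⟨hxy.snd_mem, hy⟩ hxy.ne hxy.adj_sub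

theorem IsStableSeparation.isNACColouring (h : IsStableSeparation G G₁ G₂) :
    IsNACColouring G (subgraphColouring G₁) := by
  refine isNACColouring_of_not_reachable ?_ (fun x y hxy hc => ?_) (fun x y hxy hc => ?_)
  · rintro (_ | _)
    · obtain ⟨x, hx, -⟩ := h.1.2.1
      obtain ⟨y, hxy⟩ := h.mem_left_iff.1 hx
      exact ⟨⟨s(x, y), hxy.adj_sub⟩, (subgraphColouring_eq_red hxy.adj_sub).2 hxy⟩
    · obtain ⟨x, hx, -⟩ := h.1.2.2
      obtain ⟨y, hxy⟩ := h.symm.mem_left_iff.1 hx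
      exact ⟨⟨s(x, y), hxy.adj_sub⟩, (h.subgraphColouring_eq_blue hxy.adj_sub).2 hxy⟩
  · refine h.not_reachable (fun a b hab => ?_) ((subgraphColouring_eq_red hxy).1 hc)
    obtain ⟨hab, hblue⟩ := colourGraph_adj.1 hab
    exact (h.subgraphColouring_eq_blue hab).1 hblue
  · refine h.symm.not_reachable (fun a b hab => ?_) ((h.subgraphColouring_eq_blue hxy).1 hc)
    obtain ⟨hab, hred⟩ := colourGraph_adj.1 hab
    exact (subgraphColouring_eq_red hab).1 hred

lemma two_mul_numStableSeparations_le [Finite V] (G : SimpleGraph V) :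
    2 * numStableSeparations G ≤
      {K : G.Subgraph × G.Subgraph | IsStableSeparation G K.1 K.2}.ncard := by
  let 𝓢 := {P : Sym2 G.Subgraph | ∃ G₁ G₂, P = s(G₁, G₂) ∧ IsStableSeparation G G₁ G₂}
  have mk_out : ∀ P : Sym2 G.Subgraph, s(P.out.1, P.out.2) = P := Quot.out_eq
  have out_injective : Function.Injective (fun P : Sym2 G.Subgraph => P.out) :=
    Function.LeftInverse.injective mk_out
  have hout : ∀ P ∈ 𝓢, IsStableSeparation G P.out.1 P.out.2 := by
    rintro _ ⟨G₁, G₂, rfl, h⟩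
    obtain ⟨h₁, h₂⟩ | ⟨h₁, h₂⟩ := Sym2.eq_iff.1 (mk_out s(G₁, G₂))
    · rwa [h₁, h₂]
    · rw [h₁, h₂]
      exact h.symm
  have hdisjoint : Disjoint (Quot.out '' 𝓢) (Prod.swap '' (Quot.out '' 𝓢)) := by
    rw [Set.disjoint_left]
    rintro _ ⟨P, hP, rfl⟩ ⟨_, ⟨Q, -, rfl⟩, heq⟩
    obtain rfl : Q = P := by
      rw [← mk_out Q, ← mk_out P, ← heq, Prod.fst_swap, Prod.snd_swap, Sym2.eq_swap]
    exact (hout Q hP).ne (congrArg Prod.snd heq)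
  have hcard : (Quot.out '' 𝓢).ncard = numStableSeparations G :=
    Set.ncard_image_of_injective 𝓢 out_injective
  have hunion := Set.ncard_union_eq hdisjoint
  rw [Set.ncard_image_of_injective _ Prod.swap_injective, hcard, ← two_mul] at hunion
  rw [← hunion]
  refine Set.ncard_le_ncard (Set.union_subset ?_ ?_)
  · rintro _ ⟨P, hP, rfl⟩
    exact hout P hP
  · rintro _ ⟨_, ⟨P, hP, rfl⟩, rfl⟩
    exact (hout P hP).symm

theorem numStableSeparations_le_nu [Finite V] (G : SimpleGraph V) :
    (numStableSeparations G : ℚ) ≤ nu G := by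
  have hcolourings : {K : G.Subgraph × G.Subgraph | IsStableSeparation G K.1 K.2}.ncard ≤
      {c : G.edgeSet → Colour | IsNACColouring G c}.ncard :=
    Set.ncard_le_ncard_of_injOn (fun K => subgraphColouring K.1) (fun K hK => hK.isNACColouring)
      fun K hK L hL heq => Prod.ext_iff.2 (hK.eq_of_subgraphColouring_eq hL heq)
  rw [nu, le_div_iff₀ (by norm_num), mul_comm]
  exact_mod_cast (two_mul_numStableSeparations_le G).trans hcolourings

end NACColourings

section FourBodies

open Finset

variable {V : Type*} {G : SimpleGraph V} {𝓑 𝓢 : Finset (Finset V)} {B C D R : Finset V} {x y : V}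

open Classical in
/-- The colouring in which the edges within a member of `𝓢` are red. -/
noncomputable def bodyColouring (G : SimpleGraph V) (𝓢 : Finset (Finset V)) (e : G.edgeSet) :
    Colour :=
  if ∃ B ∈ 𝓢, ∀ x ∈ (e : Sym2 V), x ∈ B then .red else .blue

variable [DecidableEq V]

lemma IsSaturated.not_reachable (h𝓑 : IsSaturated 𝓑) (hR : R ∈ 𝓑) (hB : B ∈ 𝓑) (hD : D ∈ 𝓑)
    (hRB : R ≠ B) (hRD : R ≠ D) {H : SimpleGraph V}
    (hH : ∀ a b, H.Adj a b → (a ∈ B ∧ b ∈ B) ∨ (a ∈ D ∧ b ∈ D)) (hxy : x ≠ y)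
    (hx : x ∈ R) (hy : y ∈ R) : ¬ H.Reachable x y := by
  intro hreach
  wlog hxB : x ∈ B generalizing B D
  · have hxD : x ∈ D := (mem_of_reachable (U := {v | v ∈ B ∨ v ∈ D})
      (fun a b hab => (hH a b hab).imp And.left And.left) hreach hxy).resolve_left hxB
    exact this hD hB hRD hRB (fun a b hab => (hH a b hab).symm) hxD
  have hyB : y ∉ B := fun hyB => hRB (h𝓑.eq_of_mem hR hB hxy hx hy hxB hyB)
  have hyD : y ∈ D := (mem_of_reachable (U := {v | v ∈ B ∨ v ∈ D})
    (fun a b hab => (hH a b hab).imp And.left And.left) hreach.symm hxy.symm).resolve_left hyB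
  obtain ⟨w⟩ := hreach
  -- The walk leaves `B` at a vertex of `B ∩ D`, which closes a triangle of the three bodies.
  obtain ⟨d, -, hfst, hsnd⟩ := w.exists_boundary_dart (B : Set V) hxB hyB
  have hfstD : d.fst ∈ D := ((hH _ _ d.adj).resolve_left fun h => hsnd h.2).1
  have hne : y ≠ d.fst := fun h => hyB (h ▸ hfst)
  exact hRD (h𝓑.eq_of_triangle hR hB hD hxy hne hx hxB hy hyD hfst hfstD hRB)

lemma IsSaturated.not_reachable_of_card_eq_two (h𝓑 : IsSaturated 𝓑) (h𝓢 : 𝓢 ⊆ 𝓑)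
    (hcard : #𝓢 = 2) (hR : R ∈ 𝓑) (hR𝓢 : R ∉ 𝓢) {H : SimpleGraph V}
    (hH : ∀ a b, H.Adj a b → ∃ B ∈ 𝓢, a ∈ B ∧ b ∈ B) (hxy : x ≠ y) (hx : x ∈ R) (hy : y ∈ R) :
    ¬ H.Reachable x y := by
  obtain ⟨B, D, -, rfl⟩ := card_eq_two.1 hcard
  simp only [mem_insert, mem_singleton, not_or] at hR𝓢
  simp only [mem_insert, mem_singleton, exists_eq_or_imp, exists_eq_left] at hH
  exact h𝓑.not_reachable hR (h𝓢 (by simp)) (h𝓢 (by simp)) hR𝓢.1 hR𝓢.2 hH hxy hx hy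

lemma IsSaturated.bodyColouring_eq_red (h𝓑 : IsSaturated 𝓑) (h𝓢 : 𝓢 ⊆ 𝓑) (hB : B ∈ 𝓑)
    (hxy : G.Adj x y) (hx : x ∈ B) (hy : y ∈ B) :
    bodyColouring G 𝓢 ⟨s(x, y), hxy⟩ = .red ↔ B ∈ 𝓢 := by
  have hiff : (∃ C ∈ 𝓢, ∀ v ∈ s(x, y), v ∈ C) ↔ B ∈ 𝓢 := by
    simp only [Sym2.mem_iff, forall_eq_or_imp, forall_eq]
    constructor
    · rintro ⟨C, hC, hxC, hyC⟩
      rwa [h𝓑.eq_of_mem hB (h𝓢 hC) hxy.ne hx hy hxC hyC]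
    · exact fun hB𝓢 => ⟨B, hB𝓢, hx, hy⟩
  simp [← hiff, bodyColouring]

lemma IsSaturated.bodyColouring_eq_blue (h𝓑 : IsSaturated 𝓑) (h𝓢 : 𝓢 ⊆ 𝓑) (hB : B ∈ 𝓑)
    (hxy : G.Adj x y) (hx : x ∈ B) (hy : y ∈ B) :
    bodyColouring G 𝓢 ⟨s(x, y), hxy⟩ = .blue ↔ B ∉ 𝓢 := by
  rw [← h𝓑.bodyColouring_eq_red h𝓢 hB hxy hx hy]
  exact ⟨fun h => by simp [h], Colour.eq_blue_of_ne⟩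

lemma IsBodySystem.bodyColouring_surjective (h𝓑 : IsBodySystem G 𝓑) (h𝓢 : 𝓢 ⊆ 𝓑)
    (hred : 𝓢.Nonempty) (hblue : (𝓑 \ 𝓢).Nonempty) : Function.Surjective (bodyColouring G 𝓢) := by
  rintro (_ | _)
  · obtain ⟨B, hB⟩ := hred
    obtain ⟨a, ha, b, hb, hab⟩ := h𝓑.exists_adj B (h𝓢 hB)
    exact ⟨⟨s(a, b), hab⟩, (h𝓑.bodyColouring_eq_red h𝓢 (h𝓢 hB) hab ha hb).2 hB⟩
  · obtain ⟨B, hB⟩ := hblue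
    obtain ⟨hB, hB𝓢⟩ := mem_sdiff.1 hB
    obtain ⟨a, ha, b, hb, hab⟩ := h𝓑.exists_adj B hB
    exact ⟨⟨s(a, b), hab⟩, (h𝓑.bodyColouring_eq_blue h𝓢 hB hab ha hb).2 hB𝓢⟩

lemma IsBodySystem.bodyColouring_injOn (h𝓑 : IsBodySystem G 𝓑) :
    Set.InjOn (bodyColouring G) {𝓢 | 𝓢 ⊆ 𝓑} := by
  intro 𝓢 h𝓢 𝓣 h𝓣 heq
  ext B
  by_cases hB : B ∈ 𝓑
  · obtain ⟨a, ha, b, hb, hab⟩ := h𝓑.exists_adj B hB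
    rw [← h𝓑.bodyColouring_eq_red h𝓢 hB hab ha hb, heq,
      h𝓑.bodyColouring_eq_red h𝓣 hB hab ha hb]
  · exact iff_of_false (fun h => hB (h𝓢 h)) fun h => hB (h𝓣 h)

lemma IsBodySystem.isNACColouring (h𝓑 : IsBodySystem G 𝓑) (h𝓢 : 𝓢 ⊆ 𝓑) (hred : #𝓢 = 2)
    (hblue : #(𝓑 \ 𝓢) = 2) : IsNACColouring G (bodyColouring G 𝓢) := by
  refine isNACColouring_of_not_reachable (h𝓑.bodyColouring_surjective h𝓢
    (card_pos.1 (by omega)) (card_pos.1 (by omega))) (fun x y hxy hc => ?_) fun x y hxy hc => ?_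
  · obtain ⟨R, hR, hx, hy⟩ := h𝓑.exists_mem x y hxy
    have hR𝓢 := (h𝓑.bodyColouring_eq_red h𝓢 hR hxy hx hy).1 hc
    refine h𝓑.not_reachable_of_card_eq_two sdiff_subset hblue hR
      (fun h => (mem_sdiff.1 h).2 hR𝓢) (fun a b hab => ?_) hxy.ne hx hy
    obtain ⟨hab, hc⟩ := colourGraph_adj.1 hab
    obtain ⟨B, hB, ha, hb⟩ := h𝓑.exists_mem a b hab
    exact ⟨B, mem_sdiff.2 ⟨hB, (h𝓑.bodyColouring_eq_blue h𝓢 hB hab ha hb).1 hc⟩, ha, hb⟩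
  · obtain ⟨R, hR, hx, hy⟩ := h𝓑.exists_mem x y hxy
    have hR𝓢 := (h𝓑.bodyColouring_eq_blue h𝓢 hR hxy hx hy).1 hc
    refine h𝓑.not_reachable_of_card_eq_two h𝓢 hred hR hR𝓢 (fun a b hab => ?_) hxy.ne hx hy
    obtain ⟨hab, hc⟩ := colourGraph_adj.1 hab
    obtain ⟨B, hB, ha, hb⟩ := h𝓑.exists_mem a b hab
    exact ⟨B, (h𝓑.bodyColouring_eq_red h𝓢 hB hab ha hb).1 hc, ha, hb⟩

lemma IsBodySystem.three_le_nu_of_card_eq_four [Finite V] (h𝓑 : IsBodySystem G 𝓑)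
    (hcard : #𝓑 = 4) : 3 ≤ nu G := by
  have hpairs : #(powersetCard 2 𝓑) = 6 := by
    rw [card_powersetCard, hcard]
    rfl
  have hcolourings : (powersetCard 2 𝓑 : Set (Finset (Finset V))).ncard ≤
      {c : G.edgeSet → Colour | IsNACColouring G c}.ncard := by
    refine Set.ncard_le_ncard_of_injOn (bodyColouring G) (fun 𝓢 h𝓢 => ?_)
      (h𝓑.bodyColouring_injOn.mono fun 𝓢 h𝓢 => (mem_powersetCard.1 h𝓢).1)
    obtain ⟨h𝓢, hred⟩ := mem_powersetCard.1 h𝓢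
    exact h𝓑.isNACColouring h𝓢 hred (by rw [card_sdiff_of_subset h𝓢, hcard, hred])
  rw [Set.ncard_coe_finset, hpairs] at hcolourings
  rw [nu, le_div_iff₀ (by norm_num)]
  exact_mod_cast hcolourings

end FourBodies

section TwoConnected

open Finset

variable {V : Type*} {G : SimpleGraph V} {𝓑 : Finset (Finset V)} {B : Finset V} {x y : V}

lemma exists_adj_of_preconnected (hG : G.Preconnected) {U : Set V} (hx : x ∈ U) (hy : y ∉ U) :
    ∃ a ∈ U, ∃ b, b ∉ U ∧ G.Adj a b := by
  obtain ⟨w⟩ := hG x y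
  obtain ⟨d, -, hfst, hsnd⟩ := w.exists_boundary_dart U hx hy
  exact ⟨d.fst, hfst, d.snd, hsnd, d.adj⟩

lemma IsTwoConnected.exists_adj (h : IsTwoConnected G) (v : V) : ∃ w, G.Adj v w := by
  have hcard := h.three_le_card
  have : Finite V := Nat.finite_of_card_ne_zero (by omega)
  have : Nontrivial V := Finite.one_lt_card_iff_nontrivial.1 (by omega)
  exact h.connected.preconnected.exists_adj_of_nontrivial v

lemma IsBodySystem.exists_junction [DecidableEq V] (h𝓑 : IsBodySystem G 𝓑)
    (hG : IsTwoConnected G) (hB : B ∈ 𝓑) (hy : y ∉ B) (v : V) :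
    ∃ a ∈ B, a ≠ v ∧ ∃ C ∈ 𝓑, C ≠ B ∧ a ∈ C := by
  obtain ⟨a, ha, hav, b, hb, hab⟩ : ∃ a ∈ B, a ≠ v ∧ ∃ b ∉ B, G.Adj a b := by
    obtain ⟨x, hx, hxv⟩ := exists_mem_ne (h𝓑.two_le_card B hB) v
    by_cases hvB : v ∈ B
    · have hyv : y ≠ v := fun h => hy (h ▸ hvB)
      obtain ⟨a, ha, b, hb, hab⟩ := exists_adj_of_preconnected
        (hG.connected_delete v).preconnected (U := {z | (z : V) ∈ B}) (x := ⟨x, hxv⟩)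
        (y := ⟨y, hyv⟩) hx hy
      exact ⟨a, ha, a.2, b, hb, hab⟩
    · obtain ⟨a, ha, b, hb, hab⟩ := exists_adj_of_preconnected hG.connected.preconnected
        (U := (B : Set V)) hx hy
      exact ⟨a, ha, fun h => hvB (h ▸ ha), b, hb, hab⟩
  obtain ⟨C, hC, haC, hbC⟩ := h𝓑.exists_mem a b hab
  exact ⟨a, ha, hav, C, hC, fun h => hb (h ▸ hbC), haC⟩

lemma IsBodySystem.four_le_card [DecidableEq V] (h𝓑 : IsBodySystem G 𝓑)
    (hG : IsTwoConnected G) (hproper : ∀ B ∈ 𝓑, ∃ y, y ∉ B) : 4 ≤ #𝓑 := by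
  have junction : ∀ B ∈ 𝓑, ∀ v, ∃ a ∈ B, a ≠ v ∧ ∃ C ∈ 𝓑, C ≠ B ∧ a ∈ C := fun B hB v =>
    (hproper B hB).elim fun y hy => h𝓑.exists_junction hG hB hy v
  obtain ⟨v⟩ := hG.connected.nonempty
  obtain ⟨w, hvw⟩ := hG.exists_adj v
  obtain ⟨R₁, hR₁, -⟩ := h𝓑.exists_mem v w hvw
  obtain ⟨x, hx₁, -, R₂, hR₂, h₂₁, hx₂⟩ := junction R₁ hR₁ v
  obtain ⟨y, hy₁, hyx, R₃, hR₃, h₃₁, hy₃⟩ := junction R₁ hR₁ x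
  obtain ⟨z, hz₂, hzx, R₄, hR₄, h₄₂, hz₄⟩ := junction R₂ hR₂ x
  have h₂₃ : R₂ ≠ R₃ := fun h => h₂₁ (h𝓑.eq_of_mem hR₂ hR₁ hyx (h ▸ hy₃) hx₂ hy₁ hx₁)
  have h₄₁ : R₄ ≠ R₁ := fun h => h₄₂ (h𝓑.eq_of_mem hR₄ hR₂ hzx hz₄ (h ▸ hx₁) hz₂ hx₂)
  have h₄₃ : R₄ ≠ R₃ := by
    rintro rfl
    have hyz : y ≠ z := by
      rintro rfl
      exact h₂₁ (h𝓑.eq_of_mem hR₂ hR₁ hyx hz₂ hx₂ hy₁ hx₁)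
    exact h₄₁
      (h𝓑.eq_of_triangle hR₁ hR₂ hR₄ hyx.symm hyz hx₁ hx₂ hy₁ hy₃ hz₂ hz₄ h₂₁.symm).symm
  have hcard : #{R₁, R₂, R₃, R₄} = 4 := by
    rw [card_insert_of_notMem (by simp [h₂₁.symm, h₃₁.symm, h₄₁.symm]),
      card_insert_of_notMem (by simp [h₂₃, h₄₂.symm]), card_pair h₄₃.symm]
  exact hcard ▸ card_le_card (by simp [insert_subset_iff, *])

theorem IsTwoConnected.numRigidComponents_le_two_pow [Finite V] (hG : IsTwoConnected G)
    (hflex : IsFlexible G) : numRigidComponents G ≤ 2 ^ numStableSeparations G := by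
  classical
  have := hG.connected.nonempty
  obtain ⟨p, hp⟩ := hflex.exists_isGeneric
  obtain ⟨𝓑, h𝓑⟩ := exists_isBodySystem G
  exact (h𝓑.numRigidComponents_le hp hG.exists_adj).trans h𝓑.card_le_two_pow

theorem IsTwoConnected.three_le_nu [Finite V] (hG : IsTwoConnected G) (hflex : IsFlexible G) :
    3 ≤ nu G := by
  classical
  obtain ⟨𝓑, h𝓑⟩ := exists_isBodySystem G
  obtain hfour | hfive := (h𝓑.four_le_card hG fun _ => h𝓑.exists_notMem hflex).eq_or_lt
  · exact h𝓑.three_le_nu_of_card_eq_four hfour.symm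
  · have hpow : 2 ^ 2 < 2 ^ numStableSeparations G := hfive.trans_le h𝓑.card_le_two_pow
    have hthree : 3 ≤ numStableSeparations G := (Nat.pow_lt_pow_iff_right (by norm_num)).1 hpow
    exact le_trans (by exact_mod_cast hthree) (numStableSeparations_le_nu G)

end TwoConnected

end FlexGraph

theorem lemma5p8 {V : Type*} [Finite V] (G : SimpleGraph V)
    (h2 : FlexGraph.IsTwoConnected G) (hflex : FlexGraph.IsFlexible G) :
    ⌈Real.logb 2 (FlexGraph.numRigidComponents G : ℝ)⌉₊ ≤ FlexGraph.numStableSeparations G ∧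
    ((⌈Real.logb 2 (FlexGraph.numRigidComponents G : ℝ)⌉₊ : ℕ) : ℚ) ≤ FlexGraph.nu G ∧
    3 ≤ FlexGraph.nu G := by
  have hlog : ⌈Real.logb 2 (FlexGraph.numRigidComponents G : ℝ)⌉₊ ≤
      FlexGraph.numStableSeparations G := by
    have hceil := Real.natCeil_logb_natCast 2 (FlexGraph.numRigidComponents G)
    rw [Nat.cast_ofNat] at hceil
    rw [hceil]
    exact Nat.clog_le_of_le_pow (h2.numRigidComponents_le_two_pow hflex)
  exact ⟨hlog, (Nat.cast_le.2 hlog).trans (FlexGraph.numStableSeparations_le_nu G),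
    h2.three_le_nu hflex⟩
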